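/- Let $d\ge 1$, let $\Omega\subset\mathbb R^d$ be a bounded domain (nonempty, open, connected), let $\varepsilon>0$, and let $\Omega_I=\{y\in\mathbb R^d\setminus\Omega:\ |y-x|_\infty\le\varepsilon\text{ for some }x\in\Omega\}$ be the interaction domain. Let $\gamma:\mathbb R^d\times\mathbb R^d\to[0,\infty)$ be a measurable symmetric kernel, localized with radius $\varepsilon$ and positive near the diagonal: for $x\in\Omega$, $\gamma(x,y)=0$ whenever $|x-y|_\infty>\varepsilon$, and there is $\delta>0$ such that $\gamma(x,y)>0$ whenever $x\in\Omega$ and $|x-y|_\infty\le\delta$. (In particular, $\gamma$ may be any such kernel that is in addition square integrable.) For $v\in L^2(\Omega\cup\Omega_I)$ put $$\|v\|_V^2=\int_{\Omega\cup\Omega_I}\int_{\Omega\cup\Omega_I}\big(v(x)-v(y)\big)^2\gamma(x,y)\,dy\,dx,\qquad V_c=\{v\in L^2(\Omega\cup\Omega_I):\ \|v\|_V<\infty,\ v=0\text{ a.e. on }\Omega_I\}.$$ Let $f\in L^\infty(\Omega)$, let $\mu,\beta,\Lambda>0$, and let $\ell:V_c\to\mathbb R$ be strictly convex and continuous with respect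 to the $L^2(\Omega\cup\Omega_I)$ norm. Let $$\mathcal C=\{\lambda\in H^1(\Omega):\ 0\le\lambda(x)\le\Lambda\text{ for a.e. }x\in\Omega\}.$$ **Theorem.** For every $\lambda\in\mathcal C$ the lower-level denoising problem $$\min_{u\in V_c}\ \frac{\mu}{2}\|u\|_V^2+\frac12\int_\Omega\lambda\,(u-f)^2\,dx$$ has a unique minimizer $u_\lambda\in V_c$, and the bilevel problem $$\min_{\lambda\in\mathcal C}\ \ell(u_\lambda)+\frac{\beta}{2}\|\lambda\|_{H^1(\Omega)}^2$$ admits a global solution: there is $\lambda^*\in\mathcal C$ with $\ell(u_{\lambda^*})+\frac{\beta}{2}\|\lambda^*\|_{H^1(\Omega)}^2\le \ell(u_\lambda)+\frac{\beta}{2}\|\lambda\|_{H^1(\Omega)}^2$ for all $\lambda\in\mathcal C$. -/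

import Mathlib

open MeasureTheory Set

noncomputable section

namespace NonlocalBilevel

/-- The Euclidean space `ℝ^d`. -/
abbrev E (d : ℕ) : Type := EuclideanSpace ℝ (Fin d)

/-- The space `L²(S)` of (classes of) real functions on `S ⊆ ℝ^d`, Lebesgue measure. -/
abbrev L2 {d : ℕ} (S : Set (E d)) : Type := Lp ℝ 2 (volume.restrict S)

/-! ### The Sobolev space `H¹(Ω)` -/

/-- `g` is the weak `i`-th partial derivative of `u` in `Ω`, tested against `C_c^∞(Ω)`. -/
def HasWeakPartial {d : ℕ} (Ω : Set (E d)) (i : Fin d) (u g : L2 Ω) : Prop :=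
  ∀ φ : E d → ℝ, ContDiff ℝ ((⊤ : ℕ∞) : WithTop ℕ∞) φ → HasCompactSupport φ → tsupport φ ⊆ Ω →
    ∫ x in Ω, u x * fderiv ℝ φ x (EuclideanSpace.single i 1) = - ∫ x in Ω, g x * φ x

/-- `H¹(Ω)`: functions in `L²(Ω)` together with their weak gradient in `L²(Ω)^d`. The gradient is
determined by the function, see `H1.ext_of_toLp`. -/
structure H1 {d : ℕ} (Ω : Set (E d)) where
  /-- The function itself. -/
  toLp : L2 Ω
  /-- Its weak partial derivatives. -/
  grad : Fin d → L2 Ω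
  /-- `grad` is the weak gradient of `toLp`. -/
  hasWeakPartial : ∀ i, HasWeakPartial Ω i toLp (grad i)

/-- The squared norm `‖u‖²_{H¹(Ω)} = ‖u‖²_{L²(Ω)} + ∑ᵢ ‖∂ᵢu‖²_{L²(Ω)}`. -/
def H1.normSq {d : ℕ} {Ω : Set (E d)} (u : H1 Ω) : ℝ :=
  ‖u.toLp‖ ^ 2 + ∑ i, ‖u.grad i‖ ^ 2

/-- On an open set, an element of `H¹` is determined by its underlying `L²` function. -/
theorem H1.ext_of_toLp {d : ℕ} {Ω : Set (E d)} (hΩ : IsOpen Ω) {u v : H1 Ω}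
    (h : u.toLp = v.toLp) : u = v := by
  obtain ⟨u, gu, hu⟩ := u
  obtain ⟨v, gv, hv⟩ := v
  simp only at h
  subst h
  have key : gu = gv := by
    funext i
    have hloc : ∀ w : L2 Ω, LocallyIntegrableOn (fun x => w x) Ω volume := by
      intro w
      have hw : LocallyIntegrable (fun x => w x) (volume.restrict Ω) :=
        (Lp.memLp w).locallyIntegrable (by norm_num)
      exact locallyIntegrableOn_of_locallyIntegrable_restrict hw
    have hmul : ∀ (w : L2 Ω) (φ : E d → ℝ), Continuous φ → HasCompactSupport φ →
        Integrable (fun x => w x * φ x) (volume.restrict Ω) := by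
      intro w φ hc hs
      have hw : LocallyIntegrable (fun x => w x) (volume.restrict Ω) :=
        (Lp.memLp w).locallyIntegrable (by norm_num)
      simpa [smul_eq_mul, mul_comm] using
        hw.integrable_smul_left_of_hasCompactSupport hc hs
    have hz : ∀ᵐ x ∂(volume : Measure (E d)), x ∈ Ω → gu i x - gv i x = 0 := by
      refine hΩ.ae_eq_zero_of_integral_contDiff_smul_eq_zero ((hloc _).sub (hloc _)) ?_
      intro φ h1 h2 h3
      have e1 := hu i φ h1 h2 h3
      have e2 := hv i φ h1 h2 h3
      have e3 : ∫ x in Ω, gu i x * φ x = ∫ x in Ω, gv i x * φ x := by linarith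
      have e4 : ∫ x in Ω, (gu i x * φ x - gv i x * φ x) = 0 := by
        rw [integral_sub (hmul _ _ h1.continuous h2) (hmul _ _ h1.continuous h2), e3, sub_self]
      rw [← setIntegral_eq_integral_of_forall_compl_eq_zero (s := Ω), ← e4]
      · refine integral_congr_ae (Filter.Eventually.of_forall fun x => ?_)
        simp only [smul_eq_mul]
        ring
      · intro x hx
        have : φ x = 0 := by
          by_contra hne
          exact hx (h3 (subset_tsupport φ hne))
        simp [this]
    refine Lp.ext ?_
    refine (ae_restrict_iff' hΩ.measurableSet).2 ?_
    filter_upwards [hz] with x hx hxΩ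
    exact sub_eq_zero.1 (hx hxΩ)
  subst key
  rfl

/-! ### Nonlocal energy -/

/-- The interaction domain `Ω_I = {y ∉ Ω : |y - x|_∞ ≤ ε for some x ∈ Ω}`. -/
def interactionDomain {d : ℕ} (Ω : Set (E d)) (ε : ℝ) : Set (E d) :=
  {y | y ∉ Ω ∧ ∃ x ∈ Ω, ∀ i, |x i - y i| ≤ ε}

/-- The set `Ω ∪ Ω_I`. -/
def extDomain {d : ℕ} (Ω : Set (E d)) (ε : ℝ) : Set (E d) :=
  Ω ∪ interactionDomain Ω ε

/-- A symmetric positive kernel, localized with interaction radius `ε` (in the `ℓ^∞` distance). -/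
structure IsLocalizedKernel {d : ℕ} (Ω : Set (E d)) (ε : ℝ) (γ : E d → E d → ℝ) : Prop where
  aemeasurable : AEMeasurable (Function.uncurry γ)
    ((volume : Measure (E d)).prod (volume : Measure (E d)))
  symm : ∀ x y, γ x y = γ y x
  nonneg : ∀ x y, 0 ≤ γ x y
  eq_zero : ∀ x ∈ Ω, ∀ y, (¬ ∀ i, |x i - y i| ≤ ε) → γ x y = 0
  pos : ∃ δ > 0, ∀ x ∈ Ω, ∀ y, (∀ i, |x i - y i| ≤ δ) → 0 < γ x y

/-- The squared energy seminorm `‖v‖²_V = ∫∫ (v(x) - v(y))² γ(x,y) dy dx` over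
`(Ω ∪ Ω_I) × (Ω ∪ Ω_I)`, possibly infinite. -/
def energySeminormSq {d : ℕ} (Ω : Set (E d)) (ε : ℝ) (γ : E d → E d → ℝ)
    (v : L2 (extDomain Ω ε)) : ENNReal :=
  ∫⁻ x in extDomain Ω ε, ∫⁻ y in extDomain Ω ε, ENNReal.ofReal ((v x - v y) ^ 2 * γ x y)

/-- The constrained energy space `V_c`: functions in `L²(Ω ∪ Ω_I)` of finite energy that vanish
on `Ω_I`. -/
def constrainedEnergySpace {d : ℕ} (Ω : Set (E d)) (ε : ℝ) (γ : E d → E d → ℝ) :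
    Set (L2 (extDomain Ω ε)) :=
  {v | energySeminormSq Ω ε γ v < ⊤ ∧ ∀ᵐ x ∂(volume.restrict (interactionDomain Ω ε)), v x = 0}

/-! ### The lower-level and the bilevel problem -/

/-- The denoising energy `(μ/2) ‖u‖²_V + (1/2) ∫_Ω w (u - f)²` with fidelity weight `w`. -/
def denoisingEnergy {d : ℕ} (Ω : Set (E d)) (ε : ℝ) (γ : E d → E d → ℝ) (f : E d → ℝ) (μ : ℝ)
    (w : L2 Ω) (u : L2 (extDomain Ω ε)) : ℝ :=
  μ / 2 * (energySeminormSq Ω ε γ u).toReal + 1 / 2 * ∫ x in Ω, w x * (u x - f x) ^ 2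

/-- `u` is a global minimizer over `V_c` of the denoising energy with weight `w`. -/
def IsDenoised {d : ℕ} (Ω : Set (E d)) (ε : ℝ) (γ : E d → E d → ℝ) (f : E d → ℝ) (μ : ℝ)
    (w : L2 Ω) (u : L2 (extDomain Ω ε)) : Prop :=
  u ∈ constrainedEnergySpace Ω ε γ ∧
    ∀ v ∈ constrainedEnergySpace Ω ε γ,
      denoisingEnergy Ω ε γ f μ w u ≤ denoisingEnergy Ω ε γ f μ w v

/-- The set `C` of weights in `H¹(Ω)` with values in `[0, Λ]` almost everywhere. -/
def admissibleWeights {d : ℕ} (Ω : Set (E d)) (Λ : ℝ) : Set (H1 Ω) :=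
  {w | ∀ᵐ x ∂(volume.restrict Ω), 0 ≤ w.toLp x ∧ w.toLp x ≤ Λ}

/-- The upper-level objective `J(u, w) = ℓ(u) + (β/2) ‖w‖²_{H¹(Ω)}`. -/
def bilevelObjective {d : ℕ} {Ω : Set (E d)} {ε : ℝ} (ℓ : L2 (extDomain Ω ε) → ℝ) (β : ℝ)
    (u : L2 (extDomain Ω ε)) (w : H1 Ω) : ℝ :=
  ℓ u + β / 2 * w.normSq

end NonlocalBilevel

end

noncomputable section

open Filter Topology

namespace NonlocalBilevel

/-! ### Weak compactness and lower semicontinuity -/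

section Hilbert

variable {H : Type*} [NormedAddCommGroup H] [InnerProductSpace ℝ H] [CompleteSpace H]
  [TopologicalSpace.SeparableSpace H]

/-! Both levels are solved by the direct method, with weak limits used through one property: such a
limit lies in every closed convex set that contains a tail of the sequence
(`exists_mem_of_eventually_mem_isClosed_convex`).

Lower level. The energy is convex, and lower semicontinuous by Fatou, so its sublevel sets are
closed and convex. Boundedness in L² comes from truncation rather than from a Poincaré inequality:
clamping to [-M, M], where M bounds |f|, does not raise the energy (`extendedEnergy_truncate_le`).
For uniqueness, the quadratic identity shows that two minimizers differ by a function of zero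
nonlocal energy. Extended by zero, that function is invariant under some small nonzero translation,
and iterating the translation leaves the bounded set Ω, so it vanishes
(`eq_zero_of_energySeminormSq_eq_zero`).

Upper level. A convex ℓ continuous at 0 is bounded below on bounded sets, and all states are bounded
by M, so a minimizing sequence of weights is bounded in H¹. No regularity of the boundary of Ω is
assumed; the bound Λ makes the layer near the boundary negligible in L¹, and interior translation
estimates give strong L² compactness (`exists_subseq_tendsto_weights`). For functions bounded by M,
the energies of two weights differ by at most a multiple of the L¹ distance of the weights, so a
weak limit of the states is the state of the limit weight
(`IsDenoisingData.isEnergyMinimizer_of_tendsto`). Weak lower semicontinuity of ℓ and of the gradient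
norm concludes. -/

/-- A bounded sequence in a separable Hilbert space has a weakly convergent subsequence. -/
theorem exists_subseq_tendsto_inner {x : ℕ → H} {R : ℝ} (hx : ∀ n, ‖x n‖ ≤ R) :
    ∃ φ : ℕ → ℕ, StrictMono φ ∧ ∃ y : H, ∀ z : H,
      Tendsto (fun n => inner ℝ (x (φ n)) z) atTop (𝓝 (inner ℝ y z)) := by
  have hmem : ∀ n, StrongDual.toWeakDual (InnerProductSpace.toDual ℝ H (x n)) ∈
      WeakDual.toStrongDual ⁻¹' Metric.closedBall (0 : StrongDual ℝ H) R := by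
    intro n
    have : ‖InnerProductSpace.toDual ℝ H (x n)‖ ≤ R := by simpa using hx n
    simpa using this
  obtain ⟨a, -, φ, hφ, hlim⟩ := WeakDual.isSeqCompact_closedBall ℝ H 0 R hmem
  refine ⟨φ, hφ, (InnerProductSpace.toDual ℝ H).symm (WeakDual.toStrongDual a), fun z => ?_⟩
  have h := (WeakDual.eval_continuous z).seqContinuous hlim
  rw [InnerProductSpace.toDual_symm_apply]
  exact h

/-- A bounded sequence in a separable Hilbert space has a point lying in every closed convex set
that contains the tail of the sequence. -/
theorem exists_mem_of_eventually_mem_isClosed_convex {x : ℕ → H} {R : ℝ} (hx : ∀ n, ‖x n‖ ≤ R) :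
    ∃ y : H, ∀ S : Set H, Convex ℝ S → IsClosed S → (∀ᶠ n in atTop, x n ∈ S) → y ∈ S := by
  obtain ⟨φ, hφ, y, hy⟩ := exists_subseq_tendsto_inner hx
  refine ⟨y, fun S hc hS hev => ?_⟩
  by_contra hyS
  -- A functional separating y from S stays below c along the sequence, hence at the weak limit, a
  -- contradiction.
  obtain ⟨g, c, hg, hgy⟩ := geometric_hahn_banach_closed_point hc hS hyS
  have hlim : Tendsto (fun n => g (x (φ n))) atTop (𝓝 (g y)) := by
    have := hy ((InnerProductSpace.toDual ℝ H).symm g)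
    have e : ∀ v, inner ℝ v ((InnerProductSpace.toDual ℝ H).symm g) = g v := fun v => by
      rw [real_inner_comm, InnerProductSpace.toDual_symm_apply]
    simpa only [e] using this
  have : g y ≤ c := le_of_tendsto hlim
    ((hφ.tendsto_atTop.eventually hev).mono fun n hn => (hg _ hn).le)
  linarith

end Hilbert

/-- A functional on `L²` that satisfies Fatou's inequality along almost everywhere convergent
sequences is lower semicontinuous. -/
theorem lowerSemicontinuous_of_ae_tendsto {α : Type*} {m : MeasurableSpace α} {ν : Measure α}
    {Ψ : Lp ℝ 2 ν → ENNReal}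
    (h : ∀ (u : Lp ℝ 2 ν) (s : ℕ → Lp ℝ 2 ν),
      (∀ᵐ x ∂ν, Tendsto (fun n => s n x) atTop (𝓝 (u x))) →
        Ψ u ≤ liminf (fun n => Ψ (s n)) atTop) :
    LowerSemicontinuous Ψ := by
  rw [lowerSemicontinuous_iff_isClosed_preimage]
  intro c
  refine IsSeqClosed.isClosed fun s u hs hu => ?_
  obtain ⟨φ, -, hφ⟩ := (tendstoInMeasure_of_tendsto_Lp hu).exists_seq_tendsto_ae
  refine (h u (fun n => s (φ n)) hφ).trans ?_
  exact liminf_le_of_frequently_le' (Eventually.frequently (Eventually.of_forall fun n => hs (φ n)))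

end NonlocalBilevel

namespace NonlocalBilevel

variable {d : ℕ} {Ω : Set (E d)} {ε : ℝ} {γ : E d → E d → ℝ}

/-! ### Geometry of the interaction domain -/

/-- The extended domain is the union of the translates of Ω by the vectors of the closed ℓ^∞ ball of
radius ε. -/
theorem isOpen_extDomain (hΩ : IsOpen Ω) (hε : 0 < ε) : IsOpen (extDomain Ω ε) := by
  have : extDomain Ω ε = ⋃ z ∈ {z : E d | ∀ i, |z i| ≤ ε}, (fun y => y - z) ⁻¹' Ω := by
    ext y
    simp only [extDomain, interactionDomain, mem_union, mem_ofPred_eq, mem_iUnion, mem_preimage,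
      exists_prop]
    constructor
    · rintro (hy | ⟨-, x, hx, hxy⟩)
      · exact ⟨0, by simp [hε.le], by simpa using hy⟩
      · exact ⟨y - x, fun i => by simpa [abs_sub_comm] using hxy i, by simpa using hx⟩
    · rintro ⟨z, hz, hyz⟩
      by_cases hy : y ∈ Ω
      · exact Or.inl hy
      · exact Or.inr ⟨hy, y - z, hyz, fun i => by simpa using hz i⟩
  rw [this]
  exact isOpen_biUnion fun z _ => hΩ.preimage (by fun_prop)

theorem interactionDomain_eq_diff : interactionDomain Ω ε = extDomain Ω ε \ Ω := by
  ext y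
  simp only [extDomain, Set.mem_sdiff, mem_union]
  exact ⟨fun h => ⟨Or.inr h, h.1⟩, fun h => h.1.resolve_left h.2⟩

theorem subset_extDomain : Ω ⊆ extDomain Ω ε := subset_union_left

theorem interactionDomain_subset_extDomain : interactionDomain Ω ε ⊆ extDomain Ω ε :=
  subset_union_right

theorem measurableSet_interactionDomain (hΩ : IsOpen Ω) (hε : 0 < ε) :
    MeasurableSet (interactionDomain Ω ε) := by
  rw [interactionDomain_eq_diff]
  exact (isOpen_extDomain hΩ hε).measurableSet.diff hΩ.measurableSet

theorem ae_restrict_of_ae_extDomain {p : E d → Prop} {A : Set (E d)} (hA : A ⊆ extDomain Ω ε)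
    (h : ∀ᵐ x ∂(volume.restrict (extDomain Ω ε)), p x) : ∀ᵐ x ∂(volume.restrict A), p x :=
  ae_restrict_of_ae_restrict_of_subset hA h

theorem ae_restrict_combo (a b : ℝ) (u v : L2 (extDomain Ω ε)) {A : Set (E d)}
    (hA : A ⊆ extDomain Ω ε) :
    ∀ᵐ x ∂(volume.restrict A), (a • u + b • v) x = a * u x + b * v x := by
  refine ae_restrict_of_ae_extDomain hA ?_
  filter_upwards [Lp.coeFn_add (a • u) (b • v), Lp.coeFn_smul a u, Lp.coeFn_smul b v]
    with x h1 h2 h3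
  rw [h1, Pi.add_apply, h2, h3]
  rfl

/-! ### Functions vanishing on the interaction domain -/

/-- The functions in `L²(Ω ∪ Ω_I)` that vanish almost everywhere on `Ω_I`. -/
def vanishingOnInteraction (Ω : Set (E d)) (ε : ℝ) : Set (L2 (extDomain Ω ε)) :=
  {v | ∀ᵐ x ∂(volume.restrict (interactionDomain Ω ε)), v x = 0}

theorem zero_mem_vanishingOnInteraction :
    (0 : L2 (extDomain Ω ε)) ∈ vanishingOnInteraction Ω ε :=
  ae_restrict_of_ae_extDomain interactionDomain_subset_extDomain (Lp.coeFn_zero _ _ _)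

theorem combo_mem_vanishingOnInteraction {u v : L2 (extDomain Ω ε)}
    (hu : u ∈ vanishingOnInteraction Ω ε) (hv : v ∈ vanishingOnInteraction Ω ε) (a b : ℝ) :
    a • u + b • v ∈ vanishingOnInteraction Ω ε := by
  filter_upwards [hu, hv, ae_restrict_combo a b u v interactionDomain_subset_extDomain]
    with x h1 h2 h3
  rw [h3, h1, h2]
  simp

/-- A subsequence of an L²-convergent sequence converges almost everywhere, and vanishing survives
such limits. -/
theorem isClosed_vanishingOnInteraction : IsClosed (vanishingOnInteraction Ω ε) := by
  refine IsSeqClosed.isClosed fun s u hs hu => ?_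
  obtain ⟨φ, -, hφ⟩ := (tendstoInMeasure_of_tendsto_Lp hu).exists_seq_tendsto_ae
  have h0 : ∀ᵐ x ∂(volume.restrict (interactionDomain Ω ε)), ∀ n, s n x = 0 :=
    ae_all_iff.2 hs
  filter_upwards [h0, ae_restrict_of_ae_extDomain interactionDomain_subset_extDomain hφ]
    with x h1 h2
  simp only [h1] at h2
  exact (tendsto_nhds_unique h2 tendsto_const_nhds)

/-! ### The nonlocal energy -/

theorem aemeasurable_energy_integrand (hγ : IsLocalizedKernel Ω ε γ) (v : L2 (extDomain Ω ε)) :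
    AEMeasurable (fun z : E d × E d => ENNReal.ofReal ((v z.1 - v z.2) ^ 2 * γ z.1 z.2))
      ((volume.restrict (extDomain Ω ε)).prod (volume.restrict (extDomain Ω ε))) := by
  have h1 := (Lp.aestronglyMeasurable v).aemeasurable
  have hg : AEMeasurable (Function.uncurry γ)
      ((volume.restrict (extDomain Ω ε)).prod (volume.restrict (extDomain Ω ε))) := by
    rw [Measure.prod_restrict]
    exact hγ.aemeasurable.restrict
  have h2 : AEMeasurable (fun z : E d × E d => v z.1)
      ((volume.restrict (extDomain Ω ε)).prod (volume.restrict (extDomain Ω ε))) :=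
    h1.comp_quasiMeasurePreserving Measure.quasiMeasurePreserving_fst
  have h3 : AEMeasurable (fun z : E d × E d => v z.2)
      ((volume.restrict (extDomain Ω ε)).prod (volume.restrict (extDomain Ω ε))) :=
    h1.comp_quasiMeasurePreserving Measure.quasiMeasurePreserving_snd
  exact (((h2.sub h3).pow_const 2).mul hg).ennreal_ofReal

theorem energySeminormSq_eq_lintegral_prod (hγ : IsLocalizedKernel Ω ε γ)
    (v : L2 (extDomain Ω ε)) :
    energySeminormSq Ω ε γ v = ∫⁻ z, ENNReal.ofReal ((v z.1 - v z.2) ^ 2 * γ z.1 z.2)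
      ∂((volume.restrict (extDomain Ω ε)).prod (volume.restrict (extDomain Ω ε))) := by
  rw [lintegral_prod _ (aemeasurable_energy_integrand hγ v), energySeminormSq]

theorem ae_prod_of_ae {p : E d → Prop} {ρ : Measure (E d)} [SFinite ρ] (h : ∀ᵐ x ∂ρ, p x) :
    ∀ᵐ z ∂(ρ.prod ρ), p z.1 ∧ p z.2 :=
  (Measure.quasiMeasurePreserving_fst.ae h).and (Measure.quasiMeasurePreserving_snd.ae h)

/-- The convexity identity of the quadratic form `‖·‖²_V`. -/
theorem energySeminormSq_combo (hγ : IsLocalizedKernel Ω ε γ) (u v : L2 (extDomain Ω ε))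
    {a b : ℝ} (ha : 0 ≤ a) (hb : 0 ≤ b) (hab : a + b = 1) :
    energySeminormSq Ω ε γ (a • u + b • v) + ENNReal.ofReal (a * b) * energySeminormSq Ω ε γ (u - v)
      = ENNReal.ofReal a * energySeminormSq Ω ε γ u
        + ENNReal.ofReal b * energySeminormSq Ω ε γ v := by
  simp only [energySeminormSq_eq_lintegral_prod hγ]
  rw [← lintegral_const_mul'' _ (aemeasurable_energy_integrand hγ _),
    ← lintegral_const_mul'' _ (aemeasurable_energy_integrand hγ _),
    ← lintegral_const_mul'' _ (aemeasurable_energy_integrand hγ _),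
    ← lintegral_add_left' (aemeasurable_energy_integrand hγ _),
    ← lintegral_add_left' ((aemeasurable_energy_integrand hγ _).const_mul _)]
  refine lintegral_congr_ae ?_
  filter_upwards [ae_prod_of_ae (ae_restrict_combo a b u v subset_rfl),
    ae_prod_of_ae (Lp.coeFn_sub u v)] with z h1 h2
  have hg := hγ.nonneg z.1 z.2
  rw [h1.1, h1.2, h2.1, h2.2, ← ENNReal.ofReal_mul (by positivity), ← ENNReal.ofReal_mul ha,
    ← ENNReal.ofReal_mul hb, ← ENNReal.ofReal_add (by positivity) (by positivity),
    ← ENNReal.ofReal_add (by positivity) (by positivity)]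
  congr 1
  obtain rfl : b = 1 - a := by linarith
  simp only [Pi.sub_apply]
  ring

/-- Fatou's lemma on the product space; almost everywhere convergence passes to both variables. -/
theorem lowerSemicontinuous_energySeminormSq (hγ : IsLocalizedKernel Ω ε γ) :
    LowerSemicontinuous (energySeminormSq Ω ε γ) := by
  refine lowerSemicontinuous_of_ae_tendsto fun u s h => ?_
  simp only [energySeminormSq_eq_lintegral_prod hγ]
  refine le_trans (lintegral_mono_ae ?_)
    (lintegral_liminf_le' fun n => aemeasurable_energy_integrand hγ (s n))
  filter_upwards [ae_prod_of_ae h] with z hz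
  refine le_of_eq (Tendsto.liminf_eq ?_).symm
  exact ENNReal.tendsto_ofReal (((hz.1.sub hz.2).pow 2).mul_const _)

/-! ### The fidelity term -/

/-- The fidelity term `∫_Ω w (u - f)²` as an extended nonnegative number. -/
def fidelity (f : E d → ℝ) (w : L2 Ω) (u : L2 (extDomain Ω ε)) : ENNReal :=
  ∫⁻ x in Ω, ENNReal.ofReal (w x * (u x - f x) ^ 2)

variable {f : E d → ℝ} {w : L2 Ω}

theorem aemeasurable_restrict (u : L2 (extDomain Ω ε)) :
    AEMeasurable (fun x => u x) (volume.restrict Ω) :=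
  (Lp.aestronglyMeasurable u).aemeasurable.mono_measure
    (Measure.restrict_mono subset_extDomain le_rfl)

theorem aemeasurable_fidelity_integrand (hf : AEMeasurable f (volume.restrict Ω)) (w : L2 Ω)
    (u : L2 (extDomain Ω ε)) :
    AEMeasurable (fun x => ENNReal.ofReal (w x * (u x - f x) ^ 2)) (volume.restrict Ω) :=
  ((Lp.aestronglyMeasurable w).aemeasurable.mul
    (((aemeasurable_restrict u).sub hf).pow_const 2)).ennreal_ofReal

theorem fidelity_combo_le (hf : AEMeasurable f (volume.restrict Ω))
    (hw : ∀ᵐ x ∂(volume.restrict Ω), 0 ≤ w x) (u v : L2 (extDomain Ω ε))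
    {a b : ℝ} (ha : 0 ≤ a) (hb : 0 ≤ b) (hab : a + b = 1) :
    fidelity f w (a • u + b • v)
      ≤ ENNReal.ofReal a * fidelity f w u + ENNReal.ofReal b * fidelity f w v := by
  unfold fidelity
  rw [← lintegral_const_mul'' _ (aemeasurable_fidelity_integrand hf w _),
    ← lintegral_const_mul'' _ (aemeasurable_fidelity_integrand hf w _),
    ← lintegral_add_left' ((aemeasurable_fidelity_integrand hf w _).const_mul _)]
  refine lintegral_mono_ae ?_
  filter_upwards [ae_restrict_combo a b u v subset_extDomain, hw] with x h1 hwx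
  rw [h1, ← ENNReal.ofReal_mul ha, ← ENNReal.ofReal_mul hb,
    ← ENNReal.ofReal_add (by positivity) (by positivity)]
  refine ENNReal.ofReal_le_ofReal ?_
  obtain rfl : b = 1 - a := by linarith
  have h2 : 0 ≤ w x * (a * (1 - a) * (u x - v x) ^ 2) := by positivity
  linear_combination h2

theorem lowerSemicontinuous_fidelity (hf : AEMeasurable f (volume.restrict Ω)) :
    LowerSemicontinuous (fidelity (ε := ε) f w) := by
  refine lowerSemicontinuous_of_ae_tendsto fun u s h => ?_
  refine le_trans (lintegral_mono_ae ?_)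
    (lintegral_liminf_le' fun n => aemeasurable_fidelity_integrand hf w (s n))
  filter_upwards [ae_restrict_of_ae_extDomain subset_extDomain h] with x hx
  refine le_of_eq (Tendsto.liminf_eq ?_).symm
  exact ENNReal.tendsto_ofReal (((hx.sub_const _).pow 2).const_mul _)

/-! ### The denoising energy -/

/-- The denoising energy with values in `[0, ∞]`. -/
def extendedEnergy (Ω : Set (E d)) (ε : ℝ) (γ : E d → E d → ℝ) (f : E d → ℝ) (μ : ℝ)
    (w : L2 Ω) (u : L2 (extDomain Ω ε)) : ENNReal :=
  ENNReal.ofReal (μ / 2) * energySeminormSq Ω ε γ u + ENNReal.ofReal (1 / 2) * fidelity f w u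

variable {μ : ℝ}

theorem lowerSemicontinuous_extendedEnergy (hγ : IsLocalizedKernel Ω ε γ)
    (hf : AEMeasurable f (volume.restrict Ω)) :
    LowerSemicontinuous (extendedEnergy Ω ε γ f μ w) := by
  have hmul : ∀ c : ℝ, Monotone fun x : ENNReal => ENNReal.ofReal c * x :=
    fun c x y h => by dsimp only; gcongr
  have hcont : ∀ c : ℝ, Continuous fun x : ENNReal => ENNReal.ofReal c * x :=
    fun c => ENNReal.continuous_const_mul ENNReal.ofReal_ne_top
  exact ((hcont _).comp_lowerSemicontinuous (lowerSemicontinuous_energySeminormSq hγ)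
    (hmul _)).add ((hcont _).comp_lowerSemicontinuous (lowerSemicontinuous_fidelity hf) (hmul _))

/-- The defect term is kept because uniqueness rests on it: the weight may vanish, so the fidelity
term is convex but need not be strictly convex. -/
theorem extendedEnergy_combo_le (hγ : IsLocalizedKernel Ω ε γ)
    (hf : AEMeasurable f (volume.restrict Ω)) (hw : ∀ᵐ x ∂(volume.restrict Ω), 0 ≤ w x)
    (u v : L2 (extDomain Ω ε)) {a b : ℝ} (ha : 0 ≤ a) (hb : 0 ≤ b) (hab : a + b = 1) :
    extendedEnergy Ω ε γ f μ w (a • u + b • v)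
        + ENNReal.ofReal (μ / 2) * (ENNReal.ofReal (a * b) * energySeminormSq Ω ε γ (u - v))
      ≤ ENNReal.ofReal a * extendedEnergy Ω ε γ f μ w u
        + ENNReal.ofReal b * extendedEnergy Ω ε γ f μ w v := by
  have h1 := energySeminormSq_combo hγ u v ha hb hab
  have h2 := fidelity_combo_le (w := w) hf hw u v ha hb hab
  unfold extendedEnergy
  calc _ = ENNReal.ofReal (μ / 2) * (energySeminormSq Ω ε γ (a • u + b • v)
        + ENNReal.ofReal (a * b) * energySeminormSq Ω ε γ (u - v))
        + ENNReal.ofReal (1 / 2) * fidelity f w (a • u + b • v) := by ring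
    _ ≤ ENNReal.ofReal (μ / 2) * (ENNReal.ofReal a * energySeminormSq Ω ε γ u
        + ENNReal.ofReal b * energySeminormSq Ω ε γ v)
        + ENNReal.ofReal (1 / 2) *
          (ENNReal.ofReal a * fidelity f w u + ENNReal.ofReal b * fidelity f w v) := by
      rw [h1]; gcongr
    _ = _ := by ring

/-- The sublevel sets of the denoising energy among the functions vanishing on `Ω_I`. -/
def sublevel (Ω : Set (E d)) (ε : ℝ) (γ : E d → E d → ℝ) (f : E d → ℝ) (μ : ℝ)
    (w : L2 Ω) (c : ENNReal) : Set (L2 (extDomain Ω ε)) :=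
  vanishingOnInteraction Ω ε ∩ {u | extendedEnergy Ω ε γ f μ w u ≤ c}

theorem isClosed_sublevel (hγ : IsLocalizedKernel Ω ε γ)
    (hf : AEMeasurable f (volume.restrict Ω)) (c : ENNReal) :
    IsClosed (sublevel Ω ε γ f μ w c) :=
  isClosed_vanishingOnInteraction.inter
    ((lowerSemicontinuous_extendedEnergy hγ hf).isClosed_preimage c)

theorem convex_sublevel (hγ : IsLocalizedKernel Ω ε γ)
    (hf : AEMeasurable f (volume.restrict Ω)) (hw : ∀ᵐ x ∂(volume.restrict Ω), 0 ≤ w x)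
    (c : ENNReal) : Convex ℝ (sublevel Ω ε γ f μ w c) := by
  rintro u ⟨hu, hu'⟩ v ⟨hv, hv'⟩ a b ha hb hab
  refine ⟨combo_mem_vanishingOnInteraction hu hv a b, ?_⟩
  refine (le_self_add.trans (extendedEnergy_combo_le hγ hf hw u v ha hb hab)).trans ?_
  calc _ ≤ ENNReal.ofReal a * c + ENNReal.ofReal b * c := by gcongr <;> assumption
    _ = c := by rw [← add_mul, ← ENNReal.ofReal_add ha hb, hab]; simp

/-! ### Truncation -/

/-- Truncation of a real number to `[-M, M]`. -/
def clamp (M x : ℝ) : ℝ := max (-M) (min M x)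

theorem lipschitzWith_clamp (M : ℝ) : LipschitzWith 1 (clamp M) :=
  (LipschitzWith.id.const_min M).const_max (-M)

theorem clamp_zero {M : ℝ} (hM : 0 ≤ M) : clamp M 0 = 0 := by
  simp [clamp, hM]

theorem clamp_of_abs_le {M x : ℝ} (hx : |x| ≤ M) : clamp M x = x := by
  rw [abs_le] at hx
  simp [clamp, hx.1, hx.2]

theorem abs_clamp_le {M : ℝ} (hM : 0 ≤ M) (x : ℝ) : |clamp M x| ≤ M :=
  abs_le.2 ⟨le_max_left _ _, max_le (by linarith) (min_le_left _ _)⟩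

theorem sq_clamp_sub_clamp_le (M x y : ℝ) : (clamp M x - clamp M y) ^ 2 ≤ (x - y) ^ 2 := by
  have := (lipschitzWith_clamp M).dist_le_mul x y
  rw [NNReal.coe_one, one_mul, Real.dist_eq, Real.dist_eq] at this
  exact sq_le_sq.2 this

/-- Pointwise truncation of an `L²` function to `[-M, M]`. -/
def truncate {M : ℝ} (hM : 0 ≤ M) (v : L2 (extDomain Ω ε)) : L2 (extDomain Ω ε) :=
  (lipschitzWith_clamp M).compLp (clamp_zero hM) v

theorem coeFn_truncate {M : ℝ} (hM : 0 ≤ M) (v : L2 (extDomain Ω ε)) :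
    ∀ᵐ x ∂(volume.restrict (extDomain Ω ε)), truncate hM v x = clamp M (v x) :=
  (lipschitzWith_clamp M).coeFn_compLp (clamp_zero hM) v

/-- Clamping is 1-Lipschitz, so it shrinks every difference of values of v. It also fixes the values
of f, so it shrinks |v - f| as well. -/
theorem extendedEnergy_truncate_le (hγ : IsLocalizedKernel Ω ε γ)
    (hw : ∀ᵐ x ∂(volume.restrict Ω), 0 ≤ w x) {M : ℝ} (hM : 0 ≤ M)
    (hfM : ∀ᵐ x ∂(volume.restrict Ω), |f x| ≤ M) (v : L2 (extDomain Ω ε)) :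
    extendedEnergy Ω ε γ f μ w (truncate hM v) ≤ extendedEnergy Ω ε γ f μ w v := by
  have h1 : energySeminormSq Ω ε γ (truncate hM v) ≤ energySeminormSq Ω ε γ v := by
    simp only [energySeminormSq_eq_lintegral_prod hγ]
    refine lintegral_mono_ae ?_
    filter_upwards [ae_prod_of_ae (coeFn_truncate hM v)] with z hz
    have hg := hγ.nonneg z.1 z.2
    rw [hz.1, hz.2]
    exact ENNReal.ofReal_le_ofReal (mul_le_mul_of_nonneg_right (sq_clamp_sub_clamp_le M _ _) hg)
  have h2 : fidelity f w (truncate hM v) ≤ fidelity f w v := by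
    refine lintegral_mono_ae ?_
    filter_upwards [ae_restrict_of_ae_extDomain subset_extDomain (coeFn_truncate hM v), hfM, hw]
      with x h1 h2 h3
    have := sq_clamp_sub_clamp_le M (v x) (f x)
    rw [clamp_of_abs_le h2] at this
    rw [h1]
    gcongr
  unfold extendedEnergy
  gcongr

theorem truncate_mem_vanishingOnInteraction {M : ℝ} (hM : 0 ≤ M) {v : L2 (extDomain Ω ε)}
    (hv : v ∈ vanishingOnInteraction Ω ε) : truncate hM v ∈ vanishingOnInteraction Ω ε := by
  filter_upwards [hv, ae_restrict_of_ae_extDomain interactionDomain_subset_extDomain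
    (coeFn_truncate hM v)] with x h1 h2
  rw [h2, h1, clamp_zero hM]

end NonlocalBilevel

namespace NonlocalBilevel

variable {d : ℕ} {Ω : Set (E d)} {ε : ℝ} {γ : E d → E d → ℝ}

/-! ### Functions of zero nonlocal energy -/

theorem abs_apply_le_norm (h : E d) (i : Fin d) : |h i| ≤ ‖h‖ := by
  simpa using PiLp.norm_apply_le h i

/-- A function on `ℝ^d` that vanishes almost everywhere outside a bounded set and that takes the same
value at almost all pairs of points of distance at most `δ` is zero almost everywhere. -/
theorem ae_eq_zero_of_locally_constant (hd : 1 ≤ d) (hΩ : Bornology.IsBounded Ω)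
    {g : E d → ℝ} (hg0 : ∀ᵐ x, x ∉ Ω → g x = 0) {δ : ℝ} (hδ : 0 < δ)
    (hg : ∀ᵐ z ∂((volume : Measure (E d)).prod (volume : Measure (E d))),
      ‖z.1 - z.2‖ ≤ δ → g z.1 = g z.2) :
    ∀ᵐ x, g x = 0 := by
  -- The measure-preserving map `(h, x) ↦ (x, x + h)` turns pairs of nearby points into a
  -- displacement and a base point.
  have h1 : ∀ᵐ z ∂((volume : Measure (E d)).prod (volume : Measure (E d))),
      ‖z.1‖ ≤ δ → g (z.1 + z.2) = g z.2 := by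
    have := (measurePreserving_prod_add_swap (volume : Measure (E d))
      (volume : Measure (E d))).quasiMeasurePreserving.ae hg
    filter_upwards [this] with z hz hz'
    rw [add_comm]
    refine (hz ?_).symm
    simpa using hz'
  have h2 : ∀ᵐ h : E d, ‖h‖ ≤ δ → ∀ᵐ x, g (h + x) = g x := by
    filter_upwards [Measure.ae_ae_of_ae_prod h1] with h hh hδh
    filter_upwards [hh] with x hx using hx hδh
  -- Almost every small displacement is good, and the punctured ball has positive measure since d ≥
  -- 1, so a nonzero good one exists.
  obtain ⟨h, hh, hne, hT⟩ : ∃ h : E d, ‖h‖ ≤ δ ∧ h ≠ 0 ∧ ∀ᵐ x, g (h + x) = g x := by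
    have hopen : IsOpen (Metric.ball (0 : E d) δ \ {0}) :=
      Metric.isOpen_ball.sdiff isClosed_singleton
    have hnonempty : (Metric.ball (0 : E d) δ \ {0}).Nonempty := by
      refine ⟨EuclideanSpace.single (⟨0, hd⟩ : Fin d) (δ / 2), ?_, ?_⟩
      · simp [abs_of_pos hδ, hδ]
      · simp [hδ.ne']
    have hpos := (hopen.measure_pos (volume : Measure (E d)) hnonempty).ne'
    obtain ⟨h, hmem, hP⟩ := (frequently_ae_mem_iff.2 hpos).and_eventually h2 |>.exists
    have hle : ‖h‖ ≤ δ := by simpa using (Metric.mem_ball.1 hmem.1).le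
    exact ⟨h, hle, hmem.2, hP hle⟩
  have htrans : ∀ (n : ℕ) {p : E d → Prop}, (∀ᵐ x, p x) → ∀ᵐ x, p ((n : ℝ) • h + x) :=
    fun n p hp => (measurePreserving_add_left volume ((n : ℝ) • h)).quasiMeasurePreserving.ae hp
  have hiter : ∀ᵐ x, ∀ n : ℕ, g ((n : ℝ) • h + x) = g x := by
    refine ae_all_iff.2 fun n => ?_
    induction n with
    | zero => simp
    | succ n ih =>
      filter_upwards [ih, htrans n hT] with x hx hx'
      rw [← hx, ← hx']
      congr 1
      push_cast
      module
  filter_upwards [hiter, ae_all_iff.2 fun n => htrans n hg0] with x hx hx0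
  obtain ⟨R, hR⟩ := hΩ.exists_norm_le
  -- This n makes ‖n h‖ exceed R + ‖x‖, so n h + x lies outside Ω, where g vanishes.
  obtain ⟨n, hn⟩ := exists_nat_gt ((R + ‖x‖) / ‖h‖)
  rw [← hx n]
  refine hx0 n fun hmem => ?_
  have h3 := hR _ hmem
  have h4 : ‖(n : ℝ) • h‖ ≤ ‖(n : ℝ) • h + x‖ + ‖x‖ := by
    simpa using norm_sub_le ((n : ℝ) • h + x) x
  rw [norm_smul, Real.norm_natCast] at h4
  rw [div_lt_iff₀ (norm_pos_iff.2 hne)] at hn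
  linarith

/-- The energy seminorm is a norm on the functions that vanish on the interaction domain. -/
theorem eq_zero_of_energySeminormSq_eq_zero (hd : 1 ≤ d) (hΩ : IsOpen Ω)
    (hΩ_bdd : Bornology.IsBounded Ω) (hε : 0 < ε) (hγ : IsLocalizedKernel Ω ε γ)
    {v : L2 (extDomain Ω ε)} (hv : v ∈ vanishingOnInteraction Ω ε)
    (hv0 : energySeminormSq Ω ε γ v = 0) : v = 0 := by
  obtain ⟨δ, hδ, hpos⟩ := hγ.pos
  have hS : MeasurableSet (extDomain Ω ε) := (isOpen_extDomain hΩ hε).measurableSet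
  set g : E d → ℝ := (extDomain Ω ε).indicator v with hg
  have hg0 : ∀ᵐ x, x ∉ Ω → g x = 0 := by
    have := (ae_restrict_iff' (measurableSet_interactionDomain hΩ hε)).1 hv
    filter_upwards [this] with x hx hxΩ
    by_cases hxS : x ∈ extDomain Ω ε
    · rw [hg, indicator_of_mem hxS]
      exact hx (hxS.resolve_left hxΩ)
    · rw [hg, indicator_of_notMem hxS]
  -- Below δ the kernel is positive as soon as one point lies in Ω; below ε the other point then
  -- lies in the extended domain. If neither point is in Ω, both values are zero.
  have hpair : ∀ᵐ z ∂((volume : Measure (E d)).prod (volume : Measure (E d))),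
      ‖z.1 - z.2‖ ≤ min δ ε → g z.1 = g z.2 := by
    rw [energySeminormSq_eq_lintegral_prod hγ,
      lintegral_eq_zero_iff' (aemeasurable_energy_integrand hγ v), Measure.prod_restrict] at hv0
    have h1 := (ae_restrict_iff' (hS.prod hS)).1 hv0
    filter_upwards [h1, ae_prod_of_ae hg0] with z hz hz0 hdist
    have hle : ∀ i, |z.1 i - z.2 i| ≤ min δ ε := fun i =>
      (abs_apply_le_norm (z.1 - z.2) i).trans hdist
    have hle' : ∀ i, |z.2 i - z.1 i| ≤ min δ ε := fun i => by
      rw [abs_sub_comm]; exact hle i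
    have hmem : ∀ a ∈ Ω, ∀ b, (∀ i, |b i - a i| ≤ min δ ε) → b ∈ extDomain Ω ε := by
      intro a ha b hb
      by_cases hbΩ : b ∈ Ω
      · exact Or.inl hbΩ
      · exact Or.inr ⟨hbΩ, a, ha, fun i => by
          rw [abs_sub_comm]; exact (hb i).trans (min_le_right _ _)⟩
    have hconcl : z.1 ∈ extDomain Ω ε → z.2 ∈ extDomain Ω ε → 0 < γ z.1 z.2 → g z.1 = g z.2 := by
      intro m1 m2 hγpos
      have := hz ⟨m1, m2⟩
      simp only [Pi.zero_apply, ENNReal.ofReal_eq_zero] at this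
      have h5 : (v z.1 - v z.2) ^ 2 ≤ 0 := by
        by_contra hcon
        exact absurd this (not_le.2 (mul_pos (not_le.1 hcon) hγpos))
      rw [hg, indicator_of_mem m1, indicator_of_mem m2]
      exact sub_eq_zero.1 (pow_eq_zero_iff two_ne_zero |>.1 (le_antisymm h5 (sq_nonneg _)))
    by_cases m1 : z.1 ∈ Ω
    · exact hconcl (Or.inl m1) (hmem _ m1 _ hle')
        (hpos _ m1 _ fun i => (hle i).trans (min_le_left _ _))
    · by_cases m2 : z.2 ∈ Ω
      · refine hconcl (hmem _ m2 _ hle) (Or.inl m2) ?_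
        rw [hγ.symm]
        exact hpos _ m2 _ fun i => (hle' i).trans (min_le_left _ _)
      · rw [hz0.1 m1, hz0.2 m2]
  have hzero := ae_eq_zero_of_locally_constant hd hΩ_bdd hg0 (lt_min hδ hε) hpair
  refine Lp.ext ?_
  have h6 : ∀ᵐ x ∂(volume.restrict (extDomain Ω ε)), v x = 0 := by
    refine (ae_restrict_iff' hS).2 ?_
    filter_upwards [hzero] with x hx hxS
    rwa [hg, indicator_of_mem hxS] at hx
  filter_upwards [h6, Lp.coeFn_zero ℝ 2 (volume.restrict (extDomain Ω ε))] with x h7 h8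
  rw [h7, h8]
  rfl

end NonlocalBilevel

namespace NonlocalBilevel

variable {d : ℕ} {Ω : Set (E d)}

/-! ### Translations of functions with weak derivatives -/

theorem abs_integral_mul_le (g : L2 Ω) {ψ : E d → ℝ} (hψ : MemLp ψ 2 volume) :
    |∫ x in Ω, g x * ψ x| ≤ ‖g‖ * (eLpNorm ψ 2 volume).toReal := by
  have hψ' : MemLp ψ 2 (volume.restrict Ω) := hψ.restrict Ω
  have h1 : inner ℝ hψ'.toLp g = ∫ x in Ω, g x * ψ x := by
    rw [L2.inner_def]
    refine integral_congr_ae ?_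
    filter_upwards [hψ'.coeFn_toLp] with x hx
    rw [hx]
    rfl
  rw [← h1]
  refine (abs_real_inner_le_norm _ _).trans ?_
  rw [mul_comm, Lp.norm_toLp]
  gcongr
  · exact hψ.eLpNorm_ne_top
  · exact Measure.restrict_le_self

theorem integrable_of_isBounded (hΩ : Bornology.IsBounded Ω) (u : L2 Ω) :
    Integrable (fun x => u x) (volume.restrict Ω) := by
  have : IsFiniteMeasure (volume.restrict Ω) :=
    ⟨by simpa using hΩ.measure_lt_top⟩
  exact (Lp.memLp u).integrable one_le_two

theorem fderiv_apply_eq_sum (φ : E d → ℝ) (x h : E d) :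
    fderiv ℝ φ x h = ∑ i, h i * fderiv ℝ φ x (EuclideanSpace.single i 1) := by
  conv_lhs => rw [← (EuclideanSpace.basisFun (Fin d) ℝ).sum_repr h]
  simp

/-- Translating a test function changes its pairing with `u` by at most `|h|` times the norm of the
weak gradient, as long as the translates stay inside the domain. -/
theorem abs_integral_translate_sub_le (hΩ : Bornology.IsBounded Ω) {u : L2 Ω} {g : Fin d → L2 Ω}
    (hg : ∀ i, HasWeakPartial Ω i u (g i)) {φ : E d → ℝ}
    (hφ : ContDiff ℝ ((⊤ : ℕ∞) : WithTop ℕ∞) φ) (hφc : HasCompactSupport φ) (h : E d)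
    (hsupp : ∀ t ∈ Icc (0 : ℝ) 1, ∀ x ∈ tsupport φ, x + t • h ∈ Ω) :
    |(∫ x in Ω, u x * φ (x - h)) - ∫ x in Ω, u x * φ x|
      ≤ (∑ i, |h i| * ‖g i‖) * (eLpNorm φ 2 volume).toReal := by
  have hint := integrable_of_isBounded hΩ u
  have hφ1 : ContDiff ℝ 1 φ := hφ.of_le (by exact_mod_cast le_top)
  have hdc : Continuous (fderiv ℝ φ) := hφ1.continuous_fderiv one_ne_zero
  obtain ⟨C, hC⟩ := (hφc.fderiv ℝ).exists_bound_of_continuous hdc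
  obtain ⟨C₀, hC₀⟩ := hφc.exists_bound_of_continuous hφ.continuous
  -- F moves the test function along the segment from 0 to h. Its derivative pairs u with a
  -- directional derivative of the translate, which the weak gradient controls.
  set F : ℝ → ℝ := fun t => ∫ x in Ω, u x * φ (x - t • h) with hF
  set F' : ℝ → ℝ := fun t => ∫ x in Ω, u x * -(fderiv ℝ φ (x - t • h) h) with hF'
  have hderiv : ∀ t, HasDerivAt F (F' t) t := by
    intro t
    refine (hasDerivAt_integral_of_dominated_loc_of_deriv_le (μ := volume.restrict Ω) (s := univ)
      (F := fun t x => u x * φ (x - t • h)) (F' := fun t x => u x * -(fderiv ℝ φ (x - t • h) h))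
      (bound := fun x => ‖u x‖ * (C * ‖h‖)) univ_mem (Eventually.of_forall fun s => ?_) ?_ ?_ ?_
      (hint.norm.mul_const _) ?_).2
    · exact hint.aestronglyMeasurable.mul
        (hφ.continuous.comp (by fun_prop)).aestronglyMeasurable
    · refine hint.mul_bdd (c := C₀) (hφ.continuous.comp (by fun_prop)).aestronglyMeasurable ?_
      exact Eventually.of_forall fun x => hC₀ _
    · refine hint.aestronglyMeasurable.mul (Continuous.aestronglyMeasurable ?_)
      exact ((hdc.comp (by fun_prop)).clm_apply continuous_const).neg
    · refine Eventually.of_forall fun x s _ => ?_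
      rw [norm_mul, norm_neg]
      gcongr
      exact (ContinuousLinearMap.le_opNorm _ _).trans (by gcongr; exact hC _)
    · refine Eventually.of_forall fun x s _ => ?_
      refine HasDerivAt.const_mul (u x) ?_
      have h1 : HasDerivAt (fun s : ℝ => x - s • h) (-h) s := by
        simpa using ((hasDerivAt_id s).smul_const h).const_sub x
      have h2 := ((hφ1.differentiable one_ne_zero (x - s • h)).hasFDerivAt).comp_hasDerivAt s h1
      rw [map_neg] at h2
      exact h2
  have hbound : ∀ t ∈ Icc (0 : ℝ) 1,
      ‖F' t‖ ≤ (∑ i, |h i| * ‖g i‖) * (eLpNorm φ 2 volume).toReal := by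
    intro t ht
    set ψ : E d → ℝ := fun x => φ (x - t • h) with hψ
    have hψd : ContDiff ℝ ((⊤ : ℕ∞) : WithTop ℕ∞) ψ := hφ.comp (by fun_prop)
    have hψe : ψ = φ ∘ Homeomorph.subRight (t • h) := by
      ext x; simp [hψ]
    have hψc : HasCompactSupport ψ := by
      rw [hψe]; exact hφc.comp_homeomorph _
    have hψs : tsupport ψ ⊆ Ω := by
      rw [hψe, tsupport_comp_eq_preimage]
      intro x hx
      simpa using hsupp t ht _ hx
    have hψf : ∀ x, fderiv ℝ ψ x = fderiv ℝ φ (x - t • h) := fun x => by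
      simp only [hψ]
      rw [fderiv_comp_sub]
    have hψn : eLpNorm ψ 2 volume = eLpNorm φ 2 volume := by
      rw [hψe]
      exact eLpNorm_comp_measurePreserving hφ.continuous.aestronglyMeasurable
        (measurePreserving_sub_right volume (t • h))
    have hpart : ∀ i, Integrable
        (fun x => h i * (u x * fderiv ℝ ψ x (EuclideanSpace.single i 1))) (volume.restrict Ω) := by
      intro i
      refine (hint.mul_bdd (c := C * ‖(EuclideanSpace.single i 1 : E d)‖) ?_ ?_).const_mul _
      · simp only [hψf]
        exact ((hdc.comp (by fun_prop)).clm_apply continuous_const).aestronglyMeasurable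
      · refine Eventually.of_forall fun x => ?_
        rw [hψf]
        exact (ContinuousLinearMap.le_opNorm _ _).trans (by gcongr; exact hC _)
    have hval : F' t = ∑ i, h i * ∫ x in Ω, g i x * ψ x := by
      have e1 : ∀ x, u x * -(fderiv ℝ φ (x - t • h) h)
          = -∑ i, h i * (u x * fderiv ℝ ψ x (EuclideanSpace.single i 1)) := by
        intro x
        rw [← hψf, fderiv_apply_eq_sum, mul_neg, Finset.mul_sum]
        congr 1
        exact Finset.sum_congr rfl fun i _ => by ring
      simp only [hF', e1]
      rw [integral_neg, integral_finsetSum _ fun i _ => hpart i, ← Finset.sum_neg_distrib]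
      refine Finset.sum_congr rfl fun i _ => ?_
      rw [integral_const_mul, hg i ψ hψd hψc hψs]
      ring
    rw [hval, Finset.sum_mul]
    refine (norm_sum_le _ _).trans (Finset.sum_le_sum fun i _ => ?_)
    rw [norm_mul, mul_assoc, Real.norm_eq_abs, Real.norm_eq_abs, ← hψn]
    gcongr
    exact abs_integral_mul_le (g i) (hψd.continuous.memLp_of_hasCompactSupport hψc)
  have := norm_image_sub_le_of_norm_deriv_le_segment_01' (f := F) (f' := F')
    (fun t _ => (hderiv t).hasDerivWithinAt) (fun t ht => hbound t (Ico_subset_Icc_self ht))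
  simpa [hF] using this

/-- Duality: the `L²(ℝ^d)` norm is controlled by pairings with test functions. -/
theorem norm_le_of_forall_test {D : Lp ℝ 2 (volume : Measure (E d))} {C : ℝ} (hC : 0 ≤ C)
    (h : ∀ φ : E d → ℝ, ContDiff ℝ ((⊤ : ℕ∞) : WithTop ℕ∞) φ → HasCompactSupport φ →
      |∫ x, D x * φ x| ≤ C * (eLpNorm φ 2 volume).toReal) : ‖D‖ ≤ C := by
  have hall : ∀ ψ : Lp ℝ 2 (volume : Measure (E d)), |inner ℝ D ψ| ≤ C * ‖ψ‖ := by
    have hdense := Lp.dense_hasCompactSupport_contDiff (F := ℝ)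
      (μ := (volume : Measure (E d))) (p := 2) (by norm_num)
    -- The inequality is a closed condition on ψ, so it extends from the dense set of test
    -- functions.
    have hclosed : IsClosed {ψ : Lp ℝ 2 (volume : Measure (E d)) | |inner ℝ D ψ| ≤ C * ‖ψ‖} :=
      isClosed_le (by fun_prop) (by fun_prop)
    intro ψ
    refine hclosed.closure_subset_iff.2 ?_ (hdense ψ)
    rintro ψ ⟨φ, hφe, hφc, hφ⟩
    have h1 : inner ℝ D ψ = ∫ x, D x * φ x := by
      rw [L2.inner_def]
      refine integral_congr_ae ?_
      filter_upwards [hφe] with x hx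
      rw [hx]
      exact mul_comm _ _
    rw [mem_ofPred_eq, h1, Lp.norm_def, eLpNorm_congr_ae hφe]
    exact h φ hφ hφc
  have h2 := hall D
  rw [real_inner_self_eq_norm_sq, abs_of_nonneg (sq_nonneg _), sq] at h2
  by_cases h0 : ‖D‖ = 0
  · rwa [h0]
  · exact le_of_mul_le_mul_right h2 (lt_of_le_of_ne (norm_nonneg _) (Ne.symm h0))

end NonlocalBilevel

namespace NonlocalBilevel

variable {d : ℕ} {Ω : Set (E d)}

/-! ### The translation modulus of bounded functions with bounded weak gradient -/

/-- Extension of a function on `Ω` by zero to `ℝ^d`. -/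
def zeroExtend (u : L2 Ω) : E d → ℝ := Ω.indicator u

theorem measurable_zeroExtend (hΩ : IsOpen Ω) (u : L2 Ω) : Measurable (zeroExtend u) :=
  (Lp.stronglyMeasurable u).measurable.indicator hΩ.measurableSet

theorem memLp_zeroExtend (hΩ : IsOpen Ω) (u : L2 Ω) : MemLp (zeroExtend u) 2 volume :=
  (memLp_indicator_iff_restrict hΩ.measurableSet).2 (Lp.memLp u)

theorem memLp_zeroExtend_translate (hΩ : IsOpen Ω) (u : L2 Ω) (h : E d) :
    MemLp (fun x => zeroExtend u (x + h)) 2 volume :=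
  (memLp_zeroExtend hΩ u).comp_measurePreserving (measurePreserving_add_right volume h)

theorem ae_abs_zeroExtend_le (hΩ : IsOpen Ω) {u : L2 Ω} {Λ : ℝ} (hΛ : 0 ≤ Λ)
    (hu : ∀ᵐ x ∂(volume.restrict Ω), |u x| ≤ Λ) : ∀ᵐ x, |zeroExtend u x| ≤ Λ := by
  filter_upwards [(ae_restrict_iff' hΩ.measurableSet).1 hu] with x hx
  by_cases hxΩ : x ∈ Ω
  · rw [zeroExtend, indicator_of_mem hxΩ]
    exact hx hxΩ
  · rw [zeroExtend, indicator_of_notMem hxΩ, abs_zero]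
    exact hΛ

theorem integral_zeroExtend_mul (hΩ : IsOpen Ω) (u : L2 Ω) (ψ : E d → ℝ) :
    ∫ x, zeroExtend u x * ψ x = ∫ x in Ω, u x * ψ x := by
  rw [← integral_indicator hΩ.measurableSet]
  congr 1
  ext x
  by_cases hx : x ∈ Ω <;> simp [zeroExtend, hx]

theorem integral_zeroExtend_translate_mul (hΩ : IsOpen Ω) (u : L2 Ω) (ψ : E d → ℝ) (h : E d) :
    ∫ x, zeroExtend u (x + h) * ψ x = ∫ x in Ω, u x * ψ (x - h) := by
  rw [← integral_zeroExtend_mul hΩ u fun x => ψ (x - h),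
    ← integral_add_right_eq_self (fun x => zeroExtend u x * ψ (x - h)) h]
  simp

/-- Localized translation estimate in `L²`. -/
theorem eLpNorm_cutoff_translate_sub_le (hΩ : IsOpen Ω) (hΩ_bdd : Bornology.IsBounded Ω)
    {χ : E d → ℝ} (hχ : ContDiff ℝ ((⊤ : ℕ∞) : WithTop ℕ∞) χ)
    (hχ01 : ∀ x, χ x ∈ Icc (0 : ℝ) 1) {r : ℝ}
    (hr : Metric.cthickening r (tsupport χ) ⊆ Ω) (w : H1 Ω) {h : E d} (hh : ‖h‖ ≤ r) :
    eLpNorm (fun x => χ x * (zeroExtend w.toLp (x + h) - zeroExtend w.toLp x)) 2 volume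
      ≤ ENNReal.ofReal (‖h‖ * ∑ i, ‖w.grad i‖) := by
  have hle1 : ∀ x, ‖χ x‖ ≤ 1 := fun x => by
    rw [Real.norm_eq_abs, abs_of_nonneg (hχ01 x).1]; exact (hχ01 x).2
  have hA := memLp_zeroExtend_translate hΩ w.toLp h
  have hB := memLp_zeroExtend hΩ w.toLp
  have hD : MemLp (fun x => χ x * (zeroExtend w.toLp (x + h) - zeroExtend w.toLp x)) 2 volume := by
    refine (hA.sub hB).mono (hχ.continuous.aestronglyMeasurable.mul
      (hA.sub hB).aestronglyMeasurable) (Eventually.of_forall fun x => ?_)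
    rw [norm_mul]
    exact mul_le_of_le_one_left (norm_nonneg _) (hle1 x)
  set D : Lp ℝ 2 (volume : Measure (E d)) := hD.toLp _ with hD_def
  have hDc : D =ᵐ[volume] fun x => χ x * (zeroExtend w.toLp (x + h) - zeroExtend w.toLp x) :=
    hD.coeFn_toLp
  have hkey : ‖D‖ ≤ ‖h‖ * ∑ i, ‖w.grad i‖ := by
    refine norm_le_of_forall_test (by positivity) fun φ hφ hφc => ?_
    have hχφc : HasCompactSupport (fun x => χ x * φ x) := hφc.mul_left
    have hχφ : ContDiff ℝ ((⊤ : ℕ∞) : WithTop ℕ∞) (fun x => χ x * φ x) := hχ.mul hφ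
    have hχφL : MemLp (fun x => χ x * φ x) 2 volume :=
      hχφ.continuous.memLp_of_hasCompactSupport hχφc
    -- A change of variables moves the translation from the weight to the test function χφ.
    have h1 : ∫ x, D x * φ x = (∫ x in Ω, w.toLp x * (χ (x - h) * φ (x - h)))
        - ∫ x in Ω, w.toLp x * (χ x * φ x) := by
      rw [← integral_zeroExtend_translate_mul hΩ w.toLp (fun x => χ x * φ x) h,
        ← integral_zeroExtend_mul hΩ w.toLp (fun x => χ x * φ x)]
      refine Eq.trans ?_ (integral_sub (hA.integrable_mul hχφL) (hB.integrable_mul hχφL))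
      refine integral_congr_ae ?_
      filter_upwards [hDc] with x hx
      simp only [hx]
      ring
    rw [h1]
    refine (abs_integral_translate_sub_le hΩ_bdd w.hasWeakPartial hχφ hχφc h ?_).trans ?_
    · intro t ht x hx
      refine hr (Metric.mem_cthickening_of_dist_le _ x _ _ (tsupport_mul_subset_left hx) ?_)
      rw [dist_eq_norm, add_sub_cancel_left, norm_smul, Real.norm_eq_abs, abs_of_nonneg ht.1]
      exact (mul_le_of_le_one_left (norm_nonneg _) ht.2).trans hh
    · have h2 : eLpNorm (fun x => χ x * φ x) 2 volume ≤ eLpNorm φ 2 volume := by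
        refine eLpNorm_mono fun x => ?_
        rw [norm_mul]
        exact mul_le_of_le_one_left (norm_nonneg _) (hle1 x)
      have h3 : ∑ i, |h i| * ‖w.grad i‖ ≤ ‖h‖ * ∑ i, ‖w.grad i‖ := by
        rw [Finset.mul_sum]
        exact Finset.sum_le_sum fun i _ => by gcongr; exact abs_apply_le_norm h i
      gcongr
      exact (hφ.continuous.memLp_of_hasCompactSupport hφc).eLpNorm_ne_top
  rw [hD_def, Lp.norm_toLp] at hkey
  exact (ENNReal.le_ofReal_iff_toReal_le hD.eLpNorm_ne_top (by positivity)).2 hkey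

/-- A compact set L between K and Ω contains the support of χ, which leaves a margin r for
translations inside Ω. -/
theorem exists_cutoff (hΩ : IsOpen Ω) {K : Set (E d)} (hK : IsCompact K) (hKΩ : K ⊆ Ω) :
    ∃ χ : E d → ℝ, ContDiff ℝ ((⊤ : ℕ∞) : WithTop ℕ∞) χ ∧
      (∀ x, χ x ∈ Icc (0 : ℝ) 1) ∧ (∀ x ∈ K, χ x = 1) ∧
      ∃ r > 0, Metric.cthickening r (tsupport χ) ⊆ Ω := by
  obtain ⟨L, hL, hKL, hLΩ⟩ := exists_compact_between hK hΩ hKΩ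
  obtain ⟨χ, h1, h0, h01⟩ := exists_contMDiffMap_one_nhds_of_subset_interior
    (modelWithCornersSelf ℝ (E d)) (n := ⊤) hK.isClosed hKL
  have hsupp : tsupport χ ⊆ L := closure_minimal
    (fun x hx => by by_contra hxL; exact hx (h0 x hxL)) hL.isClosed
  have hc : HasCompactSupport χ := hL.of_isClosed_subset (isClosed_tsupport _) hsupp
  obtain ⟨r, hr, hrΩ⟩ := IsCompact.exists_cthickening_subset_open hc hΩ (hsupp.trans hLΩ)
  exact ⟨χ, χ.contMDiff.contDiff, h01, fun x hx => h1.self_of_nhdsSet x hx, r, hr, hrΩ⟩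

/-- Functions with values in `[-Λ, Λ]` and bounded weak gradient are uniformly continuous in mean. -/
theorem exists_translation_modulus (hΩ : IsOpen Ω) (hΩ_bdd : Bornology.IsBounded Ω) {Λ : ℝ}
    (hΛ : 0 ≤ Λ) (K : ℝ) {η : ENNReal} (hη : η ≠ 0) :
    ∃ r > 0, ∀ w : H1 Ω, (∀ᵐ x ∂(volume.restrict Ω), |w.toLp x| ≤ Λ) →
      ∑ i, ‖w.grad i‖ ≤ K → ∀ h : E d, ‖h‖ ≤ r →
        ∫⁻ x in Ω, ‖zeroExtend w.toLp (x + h) - zeroExtend w.toLp x‖ₑ ≤ η := by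
  have hfin : volume Ω ≠ ⊤ := hΩ_bdd.measure_lt_top.ne
  have hη2 : η / 2 ≠ 0 := by simp [hη]
  -- Translation differences are at most 2Λ, so the layer outside K₀ costs at most η/2. For Λ = 0
  -- the quotient is ⊤, which is still a legitimate bound.
  obtain ⟨K₀, hK₀Ω, hK₀, hvol⟩ := hΩ.measurableSet.exists_isCompact_sdiff_lt hfin
    (ε := η / 2 / ENNReal.ofReal (2 * Λ)) (by simp [hη, ENNReal.mul_eq_top])
  obtain ⟨χ, hχ, hχ01, hχ1, r₀, hr₀, hr₀Ω⟩ := exists_cutoff hΩ hK₀ hK₀Ω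
  have hlim : Tendsto (fun r : ℝ => ENNReal.ofReal (r * K) * volume Ω ^ (1 / 2 : ℝ))
      (𝓝[>] 0) (𝓝 0) := by
    have h1 : Tendsto (fun r : ℝ => ENNReal.ofReal (r * K)) (𝓝[>] 0) (𝓝 0) := by
      have : Continuous fun r : ℝ => ENNReal.ofReal (r * K) :=
        ENNReal.continuous_ofReal.comp (by fun_prop)
      simpa using (this.tendsto 0).mono_left nhdsWithin_le_nhds
    simpa using ENNReal.Tendsto.mul_const h1 (Or.inr (ENNReal.rpow_ne_top_of_nonneg
      (by norm_num) hfin))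
  obtain ⟨r, hrη, hr⟩ := ((hlim.eventually_le_const (pos_iff_ne_zero.2 hη2)).and
    (Ioo_mem_nhdsGT hr₀)).exists
  refine ⟨r, hr.1, fun w hw hwK h hh => ?_⟩
  have hD := eLpNorm_cutoff_translate_sub_le hΩ hΩ_bdd hχ hχ01 hr₀Ω w (hh.trans hr.2.le)
  set z := zeroExtend w.toLp with hz
  have hzm : Measurable z := measurable_zeroExtend hΩ w.toLp
  have hzh : Measurable fun x => z (x + h) := hzm.comp (measurable_add_const h)
  have hDm : Measurable fun x => χ x * (z (x + h) - z x) :=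
    hχ.continuous.measurable.mul (hzh.sub hzm)
  have hae : ∀ᵐ x, |z x| ≤ Λ := ae_abs_zeroExtend_le hΩ hΛ hw
  have haeh : ∀ᵐ x, |z (x + h)| ≤ Λ :=
    (measurePreserving_add_right volume h).quasiMeasurePreserving.ae hae
  -- Cauchy–Schwarz on the finite-measure set Ω turns the localized L² estimate into an L¹ estimate.
  have hI1 : ∫⁻ x in Ω, ‖χ x * (z (x + h) - z x)‖ₑ ≤ η / 2 := by
    have h1 := eLpNorm_le_eLpNorm_mul_rpow_measure_univ (μ := volume.restrict Ω)
      (p := 1) (q := 2) one_le_two hDm.aestronglyMeasurable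
    rw [eLpNorm_one_eq_lintegral_enorm] at h1
    refine h1.trans (le_trans ?_ hrη)
    have h2 : (1 / ENNReal.toReal 1 - 1 / ENNReal.toReal 2 : ℝ) = 1 / 2 := by norm_num
    rw [h2, Measure.restrict_apply_univ]
    gcongr
    refine (eLpNorm_mono_measure _ Measure.restrict_le_self).trans (hD.trans ?_)
    gcongr
    exact le_trans (norm_nonneg _) hh
  have hI2 : ∫⁻ x in Ω, (Ω \ K₀).indicator (fun _ => ENNReal.ofReal (2 * Λ)) x ≤ η / 2 := by
    refine (setLIntegral_le_lintegral _ _).trans ?_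
    rw [lintegral_indicator_const (hΩ.measurableSet.diff hK₀.measurableSet)]
    calc _ ≤ ENNReal.ofReal (2 * Λ) * (η / 2 / ENNReal.ofReal (2 * Λ)) := by gcongr
      _ ≤ η / 2 := ENNReal.mul_div_le
  calc ∫⁻ x in Ω, ‖z (x + h) - z x‖ₑ
      ≤ ∫⁻ x in Ω, (‖χ x * (z (x + h) - z x)‖ₑ
        + (Ω \ K₀).indicator (fun _ => ENNReal.ofReal (2 * Λ)) x) := by
        refine lintegral_mono_ae ?_
        filter_upwards [ae_restrict_of_ae hae, ae_restrict_of_ae haeh,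
          ae_restrict_mem hΩ.measurableSet] with x hx1 hx2 hxΩ
        by_cases hxK : x ∈ K₀
        · rw [hχ1 x hxK, one_mul]
          exact le_self_add
        · rw [indicator_of_mem (show x ∈ Ω \ K₀ from ⟨hxΩ, hxK⟩)]
          refine le_trans ?_ le_add_self
          rw [Real.enorm_eq_ofReal_abs]
          refine ENNReal.ofReal_le_ofReal ((abs_sub _ _).trans ?_)
          linarith
    _ = (∫⁻ x in Ω, ‖χ x * (z (x + h) - z x)‖ₑ)
        + ∫⁻ x in Ω, (Ω \ K₀).indicator (fun _ => ENNReal.ofReal (2 * Λ)) x :=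
        lintegral_add_left hDm.enorm _
    _ ≤ η / 2 + η / 2 := add_le_add hI1 hI2
    _ = η := ENNReal.add_halves η

end NonlocalBilevel

namespace NonlocalBilevel

variable {d : ℕ} {Ω : Set (E d)}

/-! ### Compactness of sets of weights -/

/-- The integral of `u`, extended by zero, over the ball of radius `r` about `x`. -/
def ballIntegral (r : ℝ) (u : L2 Ω) (x : E d) : ℝ :=
  ∫ h in Metric.ball (0 : E d) r, zeroExtend u (x + h)

theorem integrableOn_zeroExtend_add (hΩ : IsOpen Ω) (u : L2 Ω) (r : ℝ) (x : E d) :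
    IntegrableOn (fun h => zeroExtend u (x + h)) (Metric.ball 0 r) volume := by
  have : IsFiniteMeasure (volume.restrict (Metric.ball (0 : E d) r)) :=
    ⟨by simpa using measure_ball_lt_top⟩
  have h1 : MemLp (fun h => zeroExtend u (x + h)) 2 volume :=
    (memLp_zeroExtend hΩ u).comp_measurePreserving (measurePreserving_add_left volume x)
  exact (h1.restrict _).integrable one_le_two

theorem measurable_uncurry_zeroExtend_add (hΩ : IsOpen Ω) (u : L2 Ω) :
    Measurable (Function.uncurry fun x h : E d => zeroExtend u (x + h)) :=
  (measurable_zeroExtend hΩ u).comp (measurable_fst.add measurable_snd)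

theorem measurable_ballIntegral (hΩ : IsOpen Ω) (r : ℝ) (u : L2 Ω) :
    Measurable (ballIntegral r u) :=
  (measurable_uncurry_zeroExtend_add hΩ u).stronglyMeasurable.integral_prod_right.measurable

theorem abs_ballIntegral_le (hΩ : IsOpen Ω) {u : L2 Ω} {Λ : ℝ} (hΛ : 0 ≤ Λ)
    (hu : ∀ᵐ x ∂(volume.restrict Ω), |u x| ≤ Λ) (r : ℝ) (x : E d) :
    |ballIntegral r u x| ≤ Λ * volume.real (Metric.ball (0 : E d) r) := by
  have h1 : ∀ᵐ h : E d, |zeroExtend u (x + h)| ≤ Λ :=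
    (measurePreserving_add_left volume x).quasiMeasurePreserving.ae (ae_abs_zeroExtend_le hΩ hΛ hu)
  exact norm_setIntegral_le_of_norm_le_const_ae (μ := volume) (s := Metric.ball (0 : E d) r)
    (f := fun h => zeroExtend u (x + h)) (C := Λ) measure_ball_lt_top (ae_restrict_of_ae h1)

/-- Integration over a ball is the pairing with the indicator of that ball, so it converges
pointwise along weakly convergent sequences. -/
theorem ballIntegral_eq_inner (hΩ : IsOpen Ω) (r : ℝ) (x : E d) :
    ∃ b : L2 Ω, ∀ u : L2 Ω, ballIntegral r u x = inner ℝ u b := by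
  have hfin : (volume.restrict Ω) (Metric.ball x r) ≠ ⊤ :=
    ((Measure.restrict_apply_le _ _).trans_lt measure_ball_lt_top).ne
  refine ⟨indicatorConstLp 2 measurableSet_ball hfin 1, fun u => ?_⟩
  rw [real_inner_comm, L2.inner_indicatorConstLp_one, ballIntegral,
    ← integral_indicator measurableSet_ball, ← integral_indicator measurableSet_ball,
    ← integral_add_left_eq_self _ (-x), ← integral_indicator hΩ.measurableSet]
  congr 1
  ext y
  have hy : -x + y ∈ Metric.ball (0 : E d) r ↔ y ∈ Metric.ball x r := by
    rw [mem_ball_zero_iff, mem_ball_iff_norm, neg_add_eq_sub]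
  by_cases h1 : y ∈ Metric.ball x r <;> by_cases h2 : y ∈ Ω <;>
    simp only [indicator, hy, h1, h2, zeroExtend, if_true, if_false, add_neg_cancel_left]

/-- Two functions are close in mean if their translation moduli are small and their ball averages are
close. -/
theorem measure_ball_mul_lintegral_sub_le (hΩ : IsOpen Ω) (r : ℝ) (η : ENNReal) {u v : L2 Ω}
    (hu : ∀ h : E d, ‖h‖ ≤ r → ∫⁻ x in Ω, ‖zeroExtend u (x + h) - zeroExtend u x‖ₑ ≤ η)
    (hv : ∀ h : E d, ‖h‖ ≤ r → ∫⁻ x in Ω, ‖zeroExtend v (x + h) - zeroExtend v x‖ₑ ≤ η) :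
    volume (Metric.ball (0 : E d) r) * ∫⁻ x in Ω, ‖u x - v x‖ₑ
      ≤ 2 * (volume (Metric.ball (0 : E d) r) * η)
        + ∫⁻ x in Ω, ‖ballIntegral r u x - ballIntegral r v x‖ₑ := by
  set B := Metric.ball (0 : E d) r with hB
  have hmeas : ∀ u : L2 Ω, Measurable (Function.uncurry fun x h : E d =>
      ‖zeroExtend u (x + h) - zeroExtend u x‖ₑ) := fun u =>
    ((measurable_uncurry_zeroExtend_add hΩ u).sub
      ((measurable_zeroExtend hΩ u).comp measurable_fst)).enorm
  have hosc : ∀ u : L2 Ω,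
      (∀ h : E d, ‖h‖ ≤ r → ∫⁻ x in Ω, ‖zeroExtend u (x + h) - zeroExtend u x‖ₑ ≤ η) →
      ∫⁻ x in Ω, ∫⁻ h in B, ‖zeroExtend u (x + h) - zeroExtend u x‖ₑ ≤ volume B * η := by
    intro u hu
    rw [lintegral_lintegral_swap (hmeas u).aemeasurable]
    calc _ ≤ ∫⁻ _ in B, η := by
          refine setLIntegral_mono measurable_const fun h hh => hu h ?_
          exact (mem_ball_zero_iff.1 hh).le
      _ = volume B * η := by rw [setLIntegral_const, mul_comm]
  have hosc_meas : ∀ u : L2 Ω, Measurable fun x =>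
      ∫⁻ h in B, ‖zeroExtend u (x + h) - zeroExtend u x‖ₑ := fun u =>
    (hmeas u).lintegral_prod_right'
  have hpt : ∀ x ∈ Ω, volume B * ‖u x - v x‖ₑ
      ≤ (∫⁻ h in B, ‖zeroExtend u (x + h) - zeroExtend u x‖ₑ)
        + (∫⁻ h in B, ‖zeroExtend v (x + h) - zeroExtend v x‖ₑ)
        + ‖ballIntegral r u x - ballIntegral r v x‖ₑ := by
    intro x hx
    have hfinB : volume B ≠ ⊤ := measure_ball_lt_top.ne
    have hi := fun u : L2 Ω => integrableOn_zeroExtend_add hΩ u r x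
    have hc : ∀ c : ℝ, IntegrableOn (fun _ : E d => c) B volume :=
      fun c => integrableOn_const hfinB
    have hdiff : ∀ u : L2 Ω, ∫ h in B, (zeroExtend u (x + h) - zeroExtend u x)
        = ballIntegral r u x - volume.real B * zeroExtend u x := fun u => by
      rw [integral_sub (hi u) (hc _), setIntegral_const, smul_eq_mul, ballIntegral]
    have hz : ∀ u : L2 Ω, zeroExtend u x = u x := fun u => indicator_of_mem hx _
    -- The point value times |B| is the ball integral minus the integrated oscillation; this is
    -- written for u and v and subtracted.
    have heq : volume.real B * (u x - v x)
        = -(∫ h in B, (zeroExtend u (x + h) - zeroExtend u x))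
          + (∫ h in B, (zeroExtend v (x + h) - zeroExtend v x))
          + (ballIntegral r u x - ballIntegral r v x) := by
      rw [hdiff, hdiff, hz, hz]; ring
    calc volume B * ‖u x - v x‖ₑ = ‖volume.real B * (u x - v x)‖ₑ := by
          rw [enorm_mul, Real.enorm_of_nonneg measureReal_nonneg, ofReal_measureReal hfinB]
      _ ≤ ‖-(∫ h in B, (zeroExtend u (x + h) - zeroExtend u x))‖ₑ
          + ‖∫ h in B, (zeroExtend v (x + h) - zeroExtend v x)‖ₑ
          + ‖ballIntegral r u x - ballIntegral r v x‖ₑ := by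
        rw [heq]
        exact (enorm_add_le _ _).trans (by gcongr; exact enorm_add_le _ _)
      _ ≤ _ := by
        rw [enorm_neg]
        gcongr <;> exact enorm_integral_le_lintegral_enorm _
  rw [← lintegral_const_mul' _ _ measure_ball_lt_top.ne]
  refine (setLIntegral_mono' hΩ.measurableSet hpt).trans ?_
  refine (lintegral_add_left ((hosc_meas u).add (hosc_meas v)) _).le.trans ?_
  simp only [Pi.add_apply]
  rw [lintegral_add_left (hosc_meas u), two_mul]
  gcongr
  · exact hosc u hu
  · exact hosc v hv

/-- Interpolation between L¹ and L^∞: pointwise, |u - v|² ≤ 2Λ |u - v|. -/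
theorem sq_norm_sub_le (hΩ_bdd : Bornology.IsBounded Ω) {u v : L2 Ω} {Λ : ℝ}
    (hu : ∀ᵐ x ∂(volume.restrict Ω), |u x| ≤ Λ) (hv : ∀ᵐ x ∂(volume.restrict Ω), |v x| ≤ Λ) :
    ‖u - v‖ ^ 2 ≤ 2 * Λ * (∫⁻ x in Ω, ‖u x - v x‖ₑ).toReal := by
  have hint : Integrable (fun x => u x - v x) (volume.restrict Ω) :=
    (integrable_of_isBounded hΩ_bdd u).sub (integrable_of_isBounded hΩ_bdd v)
  rw [← integral_norm_eq_lintegral_enorm hint.aestronglyMeasurable, ← integral_const_mul,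
    ← real_inner_self_eq_norm_sq, L2.inner_def]
  refine integral_mono_ae (L2.integrable_inner _ _) (hint.norm.const_mul _) ?_
  filter_upwards [Lp.coeFn_sub u v, hu, hv] with x h1 h2 h3
  rw [h1, Pi.sub_apply, real_inner_self_eq_norm_sq, sq]
  gcongr
  exact (abs_sub _ _).trans (by linarith)

theorem separableSpace_L2 (S : Set (E d)) : TopologicalSpace.SeparableSpace (L2 S) := by
  have : Fact ((2 : ENNReal) ≠ ⊤) := ⟨by norm_num⟩
  have : SecondCountableTopology (L2 S) := Lp.SecondCountableTopology
  infer_instance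

/-- A version of Rellich's theorem: a sequence of functions with values in `[-Λ, Λ]` on a bounded open
set whose weak gradients are bounded in `L²` has a subsequence that converges in `L²`. -/
theorem exists_subseq_tendsto_weights (hΩ : IsOpen Ω) (hΩ_bdd : Bornology.IsBounded Ω) {Λ K R : ℝ}
    (hΛ : 0 < Λ) (w : ℕ → H1 Ω) (hw : ∀ n, ∀ᵐ x ∂(volume.restrict Ω), |(w n).toLp x| ≤ Λ)
    (hwR : ∀ n, ‖(w n).toLp‖ ≤ R) (hwK : ∀ n, ∑ i, ‖(w n).grad i‖ ≤ K) :
    ∃ φ : ℕ → ℕ, StrictMono φ ∧ ∃ u : L2 Ω, Tendsto (fun n => (w (φ n)).toLp) atTop (𝓝 u) := by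
  have := separableSpace_L2 Ω
  obtain ⟨φ, hφ, y, hy⟩ := exists_subseq_tendsto_inner hwR
  refine ⟨φ, hφ, ?_⟩
  set s : ℕ → L2 Ω := fun n => (w (φ n)).toLp with hs
  -- Of the factor 4, two units come from the translation moduli and two from comparing each ball
  -- integral with that of the weak limit.
  have hcauchy : ∀ η : ENNReal, η ≠ 0 → ∃ N, ∀ n ≥ N, ∀ m ≥ N,
      ∫⁻ x in Ω, ‖s n x - s m x‖ₑ ≤ 4 * η := by
    intro η hη
    obtain ⟨r, hr, hmod⟩ := exists_translation_modulus hΩ hΩ_bdd hΛ.le K hη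
    set V := volume (Metric.ball (0 : E d) r) with hV
    have hV0 : V ≠ 0 := (Metric.measure_ball_pos volume 0 hr).ne'
    have hVtop : V ≠ ⊤ := measure_ball_lt_top.ne
    have hpt : ∀ x, Tendsto (fun n => ballIntegral r (s n) x) atTop (𝓝 (ballIntegral r y x)) := by
      intro x
      obtain ⟨b, hb⟩ := ballIntegral_eq_inner hΩ r x
      simp only [hb]
      exact hy b
    have hyb : ∀ x, |ballIntegral r y x| ≤ Λ * volume.real (Metric.ball (0 : E d) r) := fun x =>
      le_of_tendsto (hpt x).abs
        (Eventually.of_forall fun n => abs_ballIntegral_le hΩ hΛ.le (hw (φ n)) r x)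
    have hlim : Tendsto (fun n => ∫⁻ x in Ω, ‖ballIntegral r (s n) x - ballIntegral r y x‖ₑ)
        atTop (𝓝 (∫⁻ _ in Ω, 0)) := by
      refine tendsto_lintegral_of_dominated_convergence
        (fun _ => ENNReal.ofReal (2 * (Λ * volume.real (Metric.ball (0 : E d) r))))
        (fun n => ((measurable_ballIntegral hΩ r _).sub (measurable_ballIntegral hΩ r _)).enorm)
        (fun n => Eventually.of_forall fun x => ?_) ?_ (Eventually.of_forall fun x => ?_)
      · simp only [Real.enorm_eq_ofReal_abs]
        refine ENNReal.ofReal_le_ofReal ((abs_sub _ _).trans ?_)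
        have := abs_ballIntegral_le hΩ hΛ.le (hw (φ n)) r x
        have := hyb x
        linarith
      · rw [setLIntegral_const]
        exact ENNReal.mul_ne_top ENNReal.ofReal_ne_top hΩ_bdd.measure_lt_top.ne
      · have := ((hpt x).sub_const (ballIntegral r y x)).enorm
        simpa using this
    rw [lintegral_zero] at hlim
    obtain ⟨N, hN⟩ := eventually_atTop.1
      (hlim.eventually_le_const (pos_iff_ne_zero.2 (mul_ne_zero hV0 hη)))
    refine ⟨N, fun n hn m hm => ?_⟩
    have hdiff : ∫⁻ x in Ω, ‖ballIntegral r (s n) x - ballIntegral r (s m) x‖ₑ ≤ 2 * (V * η) := by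
      calc _ ≤ ∫⁻ x in Ω, (‖ballIntegral r (s n) x - ballIntegral r y x‖ₑ
              + ‖ballIntegral r (s m) x - ballIntegral r y x‖ₑ) := by
            refine lintegral_mono fun x => ?_
            rw [← sub_sub_sub_cancel_right _ _ (ballIntegral r y x)]
            exact enorm_sub_le
        _ = _ := lintegral_add_left
            ((measurable_ballIntegral hΩ r _).sub (measurable_ballIntegral hΩ r _)).enorm _
        _ ≤ V * η + V * η := add_le_add (hN n hn) (hN m hm)
        _ = 2 * (V * η) := (two_mul _).symm
    have hmain := measure_ball_mul_lintegral_sub_le hΩ r η (hmod (w (φ n)) (hw _) (hwK _))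
      (hmod (w (φ m)) (hw _) (hwK _))
    have hmain' : V * ∫⁻ x in Ω, ‖s n x - s m x‖ₑ ≤ V * (4 * η) := by
      refine (hmain.trans (add_le_add le_rfl hdiff)).trans (le_of_eq ?_)
      ring
    exact (ENNReal.mul_le_mul_iff_right hV0 hVtop).1 hmain'
  refine cauchySeq_tendsto_of_complete (Metric.cauchySeq_iff.2 fun e he => ?_)
  -- With this η the interpolation bound is 2Λ · 4η = e²/2.
  obtain ⟨N, hN⟩ := hcauchy (ENNReal.ofReal (e ^ 2 / (16 * Λ)))
    (by simpa using by positivity)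
  refine ⟨N, fun n hn m hm => ?_⟩
  rw [dist_eq_norm]
  refine lt_of_pow_lt_pow_left₀ 2 he.le ?_
  have h1 := sq_norm_sub_le hΩ_bdd (hw (φ n)) (hw (φ m))
  have h2 : (∫⁻ x in Ω, ‖s n x - s m x‖ₑ).toReal ≤ 4 * (e ^ 2 / (16 * Λ)) := by
    refine ENNReal.toReal_le_of_le_ofReal (by positivity) ((hN n hn m hm).trans (le_of_eq ?_))
    rw [ENNReal.ofReal_mul (by norm_num)]
    norm_num
  calc ‖s n - s m‖ ^ 2 ≤ 2 * Λ * (4 * (e ^ 2 / (16 * Λ))) := h1.trans (by gcongr)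
    _ = e ^ 2 / 2 := by field_simp; norm_num
    _ < e ^ 2 := half_lt_self (by positivity)

end NonlocalBilevel

namespace NonlocalBilevel

variable {d : ℕ} {Ω : Set (E d)} {ε : ℝ} {γ : E d → E d → ℝ} {f : E d → ℝ} {μ M Λ : ℝ}

/-! ### The lower-level problem -/

/-- The standing assumptions on the data of the denoising problem. -/
structure IsDenoisingData (Ω : Set (E d)) (ε : ℝ) (γ : E d → E d → ℝ) (f : E d → ℝ) (μ M : ℝ) :
    Prop where
  one_le_dim : 1 ≤ d
  isOpen : IsOpen Ω
  isBounded : Bornology.IsBounded Ω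
  eps_pos : 0 < ε
  kernel : IsLocalizedKernel Ω ε γ
  aemeasurable : AEMeasurable f (volume.restrict Ω)
  bound_nonneg : 0 ≤ M
  abs_le : ∀ᵐ x ∂(volume.restrict Ω), |f x| ≤ M
  mu_pos : 0 < μ

/-- The weights with values in `[0, Λ]`. -/
def IsWeight (Λ : ℝ) (w : L2 Ω) : Prop :=
  ∀ᵐ x ∂(volume.restrict Ω), 0 ≤ w x ∧ w x ≤ Λ

theorem IsWeight.nonneg {w : L2 Ω} (hw : IsWeight Λ w) : ∀ᵐ x ∂(volume.restrict Ω), 0 ≤ w x :=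
  hw.mono fun _ h => h.1

theorem IsWeight.abs_le {w : L2 Ω} (hw : IsWeight Λ w) : ∀ᵐ x ∂(volume.restrict Ω), |w x| ≤ Λ :=
  hw.mono fun _ h => by rw [abs_of_nonneg h.1]; exact h.2

/-- `u` minimizes the extended denoising energy among the functions vanishing on `Ω_I`. -/
def IsEnergyMinimizer (Ω : Set (E d)) (ε : ℝ) (γ : E d → E d → ℝ) (f : E d → ℝ) (μ : ℝ)
    (w : L2 Ω) (u : L2 (extDomain Ω ε)) : Prop :=
  u ∈ vanishingOnInteraction Ω ε ∧
    ∀ v ∈ vanishingOnInteraction Ω ε, extendedEnergy Ω ε γ f μ w u ≤ extendedEnergy Ω ε γ f μ w v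

theorem isBounded_extDomain (hΩ : Bornology.IsBounded Ω) : Bornology.IsBounded (extDomain Ω ε) := by
  obtain ⟨R, hR⟩ := hΩ.exists_norm_le
  refine hΩ.union (isBounded_iff_forall_norm_le.2 ⟨R + ∑ _ : Fin d, ε, ?_⟩)
  rintro y ⟨-, x, hx, hxy⟩
  have h1 : ‖y - x‖ ≤ ∑ _ : Fin d, ε := by
    conv_lhs => rw [← (EuclideanSpace.basisFun (Fin d) ℝ).sum_repr (y - x)]
    refine (norm_sum_le _ _).trans (Finset.sum_le_sum fun i _ => ?_)
    have := hxy i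
    rw [abs_sub_comm] at this
    simpa [norm_smul] using this
  have h2 : ‖y‖ ≤ ‖x‖ + ‖y - x‖ := by simpa using norm_add_le x (y - x)
  linarith [hR x hx]

theorem exists_norm_le_of_ae_abs_le (hΩ : Bornology.IsBounded Ω) (ε M : ℝ) (hM : 0 ≤ M) :
    ∃ R, ∀ u : L2 (extDomain Ω ε),
      (∀ᵐ x ∂(volume.restrict (extDomain Ω ε)), |u x| ≤ M) → ‖u‖ ≤ R := by
  have : IsFiniteMeasure (volume.restrict (extDomain Ω ε)) :=
    ⟨by simpa using (isBounded_extDomain hΩ).measure_lt_top⟩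
  exact ⟨_, fun u hu => Lp.norm_le_of_ae_bound hM hu⟩

section

variable {w : L2 Ω} {u v : L2 (extDomain Ω ε)}

theorem IsDenoisingData.integrable_fidelity (D : IsDenoisingData Ω ε γ f μ M)
    (hw : IsWeight Λ w) (u : L2 (extDomain Ω ε)) :
    Integrable (fun x => w x * (u x - f x) ^ 2) (volume.restrict Ω) := by
  have : IsFiniteMeasure (volume.restrict Ω) := ⟨by simpa using D.isBounded.measure_lt_top⟩
  have h1 : MemLp (fun x => u x) 2 (volume.restrict Ω) :=
    (Lp.memLp u).mono_measure (Measure.restrict_mono subset_extDomain le_rfl)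
  have h2 : MemLp f 2 (volume.restrict Ω) :=
    MemLp.of_bound D.aemeasurable.aestronglyMeasurable M D.abs_le
  exact (h1.sub h2).integrable_sq.bdd_mul (Lp.aestronglyMeasurable w) hw.abs_le

theorem IsDenoisingData.integral_fidelity (D : IsDenoisingData Ω ε γ f μ M)
    (hw : IsWeight Λ w) (u : L2 (extDomain Ω ε)) :
    ∫ x in Ω, w x * (u x - f x) ^ 2 = (fidelity f w u).toReal := by
  refine integral_eq_lintegral_of_nonneg_ae ?_ (D.integrable_fidelity hw u).aestronglyMeasurable
  filter_upwards [hw.nonneg] with x hx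
  exact mul_nonneg hx (sq_nonneg _)

theorem IsDenoisingData.fidelity_ne_top (D : IsDenoisingData Ω ε γ f μ M)
    (hw : IsWeight Λ w) (u : L2 (extDomain Ω ε)) : fidelity f w u ≠ ⊤ :=
  (D.integrable_fidelity hw u).lintegral_lt_top.ne

theorem IsDenoisingData.extendedEnergy_ne_top_iff (D : IsDenoisingData Ω ε γ f μ M)
    (hw : IsWeight Λ w) (u : L2 (extDomain Ω ε)) :
    extendedEnergy Ω ε γ f μ w u ≠ ⊤ ↔ energySeminormSq Ω ε γ u < ⊤ := by
  have h1 : ENNReal.ofReal (μ / 2) ≠ 0 := by simpa using D.mu_pos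
  have h2 := D.fidelity_ne_top hw u
  rw [extendedEnergy, ENNReal.add_ne_top, lt_top_iff_ne_top]
  constructor
  · rintro ⟨h, -⟩ h'
    exact h (by rw [h', ENNReal.mul_top h1])
  · exact fun h => ⟨ENNReal.mul_ne_top ENNReal.ofReal_ne_top h,
      ENNReal.mul_ne_top ENNReal.ofReal_ne_top h2⟩

theorem IsDenoisingData.denoisingEnergy_eq (D : IsDenoisingData Ω ε γ f μ M)
    (hw : IsWeight Λ w) (hu : energySeminormSq Ω ε γ u < ⊤) :
    denoisingEnergy Ω ε γ f μ w u = (extendedEnergy Ω ε γ f μ w u).toReal := by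
  have hμ : 0 ≤ μ / 2 := by linarith [D.mu_pos]
  rw [extendedEnergy, ENNReal.toReal_add (ENNReal.mul_ne_top ENNReal.ofReal_ne_top hu.ne)
    (ENNReal.mul_ne_top ENNReal.ofReal_ne_top (D.fidelity_ne_top hw u)), ENNReal.toReal_mul,
    ENNReal.toReal_mul, ENNReal.toReal_ofReal hμ, ENNReal.toReal_ofReal (by norm_num),
    denoisingEnergy, D.integral_fidelity hw]

theorem energySeminormSq_zero (hγ : IsLocalizedKernel Ω ε γ) :
    energySeminormSq Ω ε γ (0 : L2 (extDomain Ω ε)) = 0 := by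
  rw [energySeminormSq_eq_lintegral_prod hγ]
  refine (lintegral_congr_ae ?_).trans lintegral_zero
  filter_upwards [ae_prod_of_ae (Lp.coeFn_zero ℝ 2 (volume.restrict (extDomain Ω ε)))] with z hz
  rw [hz.1, hz.2]
  simp

theorem IsDenoisingData.extendedEnergy_zero_ne_top (D : IsDenoisingData Ω ε γ f μ M)
    (hw : IsWeight Λ w) : extendedEnergy Ω ε γ f μ w (0 : L2 (extDomain Ω ε)) ≠ ⊤ := by
  rw [D.extendedEnergy_ne_top_iff hw, energySeminormSq_zero D.kernel]
  exact ENNReal.zero_lt_top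

theorem IsDenoisingData.ne_top_of_isEnergyMinimizer (D : IsDenoisingData Ω ε γ f μ M)
    (hw : IsWeight Λ w) (hu : IsEnergyMinimizer Ω ε γ f μ w u) :
    extendedEnergy Ω ε γ f μ w u ≠ ⊤ :=
  ((hu.2 0 zero_mem_vanishingOnInteraction).trans_lt
    (lt_top_iff_ne_top.2 (D.extendedEnergy_zero_ne_top hw))).ne

/-- The real-valued energy goes through `toReal`, which sends ⊤ to 0. Both energies agree at finite
nonlocal energy; elsewhere the extended energy is ⊤ and cannot compete. -/
theorem IsDenoisingData.isDenoised_iff (D : IsDenoisingData Ω ε γ f μ M) (hw : IsWeight Λ w) :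
    IsDenoised Ω ε γ f μ w u ↔ IsEnergyMinimizer Ω ε γ f μ w u := by
  constructor
  · rintro ⟨⟨hu1, hu2⟩, hmin⟩
    refine ⟨hu2, fun v hv => ?_⟩
    by_cases hv1 : energySeminormSq Ω ε γ v < ⊤
    · have := hmin v ⟨hv1, hv⟩
      rwa [D.denoisingEnergy_eq hw hu1, D.denoisingEnergy_eq hw hv1, ENNReal.toReal_le_toReal
        ((D.extendedEnergy_ne_top_iff hw u).2 hu1) ((D.extendedEnergy_ne_top_iff hw v).2 hv1)]
        at this
    · rw [← D.extendedEnergy_ne_top_iff hw, not_not] at hv1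
      rw [hv1]
      exact le_top
  · intro hu
    have hu1 := D.ne_top_of_isEnergyMinimizer hw hu
    have hu2 := (D.extendedEnergy_ne_top_iff hw u).1 hu1
    refine ⟨⟨hu2, hu.1⟩, fun v hv => ?_⟩
    rw [D.denoisingEnergy_eq hw hu2, D.denoisingEnergy_eq hw hv.1]
    exact ENNReal.toReal_mono ((D.extendedEnergy_ne_top_iff hw v).2 hv.1) (hu.2 v hv.2)

/-- At the midpoint of two minimizers the convexity defect must vanish, and the seminorm is definite
on functions vanishing on the interaction domain. -/
theorem IsDenoisingData.isEnergyMinimizer_unique (D : IsDenoisingData Ω ε γ f μ M)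
    (hw : IsWeight Λ w) (hu : IsEnergyMinimizer Ω ε γ f μ w u)
    (hv : IsEnergyMinimizer Ω ε γ f μ w v) : u = v := by
  have htop := D.ne_top_of_isEnergyMinimizer hw hu
  have heq : extendedEnergy Ω ε γ f μ w v = extendedEnergy Ω ε γ f μ w u :=
    le_antisymm (hv.2 u hu.1) (hu.2 v hv.1)
  have h1 := extendedEnergy_combo_le (μ := μ) D.kernel D.aemeasurable hw.nonneg u v
    (a := 1 / 2) (b := 1 / 2) (by norm_num) (by norm_num) (by norm_num)
  have hmid := hu.2 _ (combo_mem_vanishingOnInteraction hu.1 hv.1 (1 / 2) (1 / 2))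
  rw [heq, ← add_mul, ← ENNReal.ofReal_add (by norm_num) (by norm_num), add_halves,
    ENNReal.ofReal_one, one_mul] at h1
  have h2 : extendedEnergy Ω ε γ f μ w u
      + ENNReal.ofReal (μ / 2) * (ENNReal.ofReal (1 / 2 * (1 / 2)) * energySeminormSq Ω ε γ (u - v))
      ≤ extendedEnergy Ω ε γ f μ w u + 0 := by
    rw [add_zero]
    exact le_trans (by gcongr) h1
  have h3 := nonpos_iff_eq_zero.1 (ENNReal.le_of_add_le_add_left htop h2)
  have hμ : ENNReal.ofReal (μ / 2) ≠ 0 := by simpa using D.mu_pos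
  have hq : ENNReal.ofReal (1 / 2 * (1 / 2)) ≠ 0 := by norm_num
  have h4 : energySeminormSq Ω ε γ (u - v) = 0 := by
    rcases mul_eq_zero.1 h3 with h | h
    · exact absurd h hμ
    · exact (mul_eq_zero.1 h).resolve_left hq
  have hmem : u - v ∈ vanishingOnInteraction Ω ε := by
    have := combo_mem_vanishingOnInteraction hu.1 hv.1 1 (-1)
    rwa [one_smul, neg_one_smul, ← sub_eq_add_neg] at this
  exact sub_eq_zero.1 (eq_zero_of_energySeminormSq_eq_zero D.one_le_dim D.isOpen D.isBounded
    D.eps_pos D.kernel hmem h4)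

/-- The truncation of a minimizer is again a minimizer, so by uniqueness it is the minimizer itself.
-/
theorem IsDenoisingData.ae_abs_le_of_isEnergyMinimizer (D : IsDenoisingData Ω ε γ f μ M)
    (hw : IsWeight Λ w) (hu : IsEnergyMinimizer Ω ε γ f μ w u) :
    ∀ᵐ x ∂(volume.restrict (extDomain Ω ε)), |u x| ≤ M := by
  have hT : IsEnergyMinimizer Ω ε γ f μ w (truncate D.bound_nonneg u) :=
    ⟨truncate_mem_vanishingOnInteraction _ hu.1, fun v hv =>
      (extendedEnergy_truncate_le D.kernel hw.nonneg D.bound_nonneg D.abs_le u).trans (hu.2 v hv)⟩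
  have h1 := coeFn_truncate D.bound_nonneg u
  rw [D.isEnergyMinimizer_unique hw hT hu] at h1
  filter_upwards [h1] with x hx
  rw [hx]
  exact abs_clamp_le D.bound_nonneg _

/-- A point in all closed convex sets that contain a tail of a minimizing sequence is a minimizer. -/
theorem IsDenoisingData.isEnergyMinimizer_of_forall_mem (D : IsDenoisingData Ω ε γ f μ M)
    (hw : IsWeight Λ w) {s : ℕ → L2 (extDomain Ω ε)} {y : L2 (extDomain Ω ε)}
    (hy : ∀ S : Set (L2 (extDomain Ω ε)), Convex ℝ S → IsClosed S →
      (∀ᶠ n in atTop, s n ∈ S) → y ∈ S)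
    {m : ENNReal} (hm : m ≠ ⊤)
    (hs : ∀ n, s n ∈ vanishingOnInteraction Ω ε)
    (hsm : ∀ c > m, ∀ᶠ n in atTop, extendedEnergy Ω ε γ f μ w (s n) ≤ c)
    (hle : ∀ v ∈ vanishingOnInteraction Ω ε, m ≤ extendedEnergy Ω ε γ f μ w v) :
    IsEnergyMinimizer Ω ε γ f μ w y := by
  have hmem : ∀ c > m, y ∈ sublevel Ω ε γ f μ w c := fun c hc =>
    hy _ (convex_sublevel D.kernel D.aemeasurable hw.nonneg c)
      (isClosed_sublevel D.kernel D.aemeasurable c) ((hsm c hc).mono fun n hn => ⟨hs n, hn⟩)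
  -- The level ⊤ is above m and gives the vanishing condition alone.
  refine ⟨(hmem ⊤ (lt_top_iff_ne_top.2 hm)).1, fun v hv => le_trans ?_ (hle v hv)⟩
  exact le_of_forall_gt_imp_ge_of_dense fun c hc => (hmem c hc).2

/-- Truncating a minimizing sequence keeps it minimizing and bounds it in L², since the extended
domain has finite measure. -/
theorem IsDenoisingData.exists_isEnergyMinimizer (D : IsDenoisingData Ω ε γ f μ M)
    (hw : IsWeight Λ w) : ∃ u, IsEnergyMinimizer Ω ε γ f μ w u := by
  have := separableSpace_L2 (extDomain Ω ε)
  obtain ⟨R, hR⟩ := exists_norm_le_of_ae_abs_le D.isBounded ε M D.bound_nonneg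
  set A := extendedEnergy Ω ε γ f μ w '' vanishingOnInteraction Ω ε with hA
  have hA0 : A.Nonempty := ⟨_, 0, zero_mem_vanishingOnInteraction, rfl⟩
  obtain ⟨t, -, ht, htA⟩ := exists_seq_tendsto_sInf hA0 (OrderBot.bddBelow A)
  choose v hv hvt using htA
  have hT := fun n => truncate_mem_vanishingOnInteraction D.bound_nonneg (hv n)
  have hTb : ∀ n, ‖truncate D.bound_nonneg (v n)‖ ≤ R := fun n => hR _ (by
    filter_upwards [coeFn_truncate D.bound_nonneg (v n)] with x hx
    rw [hx]
    exact abs_clamp_le D.bound_nonneg _)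
  obtain ⟨y, hy⟩ := exists_mem_of_eventually_mem_isClosed_convex hTb
  refine ⟨y, D.isEnergyMinimizer_of_forall_mem hw hy (m := sInf A) ?_ hT ?_
    fun v hv => sInf_le (mem_image_of_mem _ hv)⟩
  · exact ((sInf_le (mem_image_of_mem _ zero_mem_vanishingOnInteraction)).trans_lt
      (lt_top_iff_ne_top.2 (D.extendedEnergy_zero_ne_top hw))).ne
  · intro c hc
    filter_upwards [ht.eventually_le_const hc] with n hn
    refine (extendedEnergy_truncate_le D.kernel hw.nonneg D.bound_nonneg D.abs_le _).trans ?_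
    rw [hvt]
    exact hn

/-! ### Dependence on the weight -/

/-- Since |u| and |f| are at most M, (u - f)² ≤ 4M², so the weight enters only through its L¹
distance. -/
theorem IsDenoisingData.extendedEnergy_le_add (D : IsDenoisingData Ω ε γ f μ M) {w w' : L2 Ω}
    (hu : ∀ᵐ x ∂(volume.restrict (extDomain Ω ε)), |u x| ≤ M) (hw' : IsWeight Λ w') :
    extendedEnergy Ω ε γ f μ w u ≤ extendedEnergy Ω ε γ f μ w' u
      + ENNReal.ofReal (4 * M ^ 2) * ∫⁻ x in Ω, ‖w x - w' x‖ₑ := by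
  have hm : AEMeasurable (fun x => ‖w x - w' x‖ₑ) (volume.restrict Ω) :=
    ((Lp.aestronglyMeasurable w).sub (Lp.aestronglyMeasurable w')).enorm
  have h1 : fidelity f w u ≤ fidelity f w' u
      + ENNReal.ofReal (4 * M ^ 2) * ∫⁻ x in Ω, ‖w x - w' x‖ₑ := by
    unfold fidelity
    rw [← lintegral_const_mul'' _ hm,
      ← lintegral_add_left' (aemeasurable_fidelity_integrand D.aemeasurable w' u)]
    refine lintegral_mono_ae ?_
    filter_upwards [ae_restrict_of_ae_extDomain subset_extDomain hu, D.abs_le, hw'.nonneg]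
      with x hx1 hx2 hx3
    have h2 : (u x - f x) ^ 2 ≤ 4 * M ^ 2 := by
      have : |u x - f x| ≤ 2 * M := (abs_sub _ _).trans (by linarith)
      calc (u x - f x) ^ 2 = |u x - f x| ^ 2 := (sq_abs _).symm
        _ ≤ (2 * M) ^ 2 := by gcongr
        _ = 4 * M ^ 2 := by ring
    rw [Real.enorm_eq_ofReal_abs, ← ENNReal.ofReal_mul (by positivity),
      ← ENNReal.ofReal_add (by positivity) (by positivity)]
    refine ENNReal.ofReal_le_ofReal ?_
    calc w x * (u x - f x) ^ 2 = w' x * (u x - f x) ^ 2 + (w x - w' x) * (u x - f x) ^ 2 := by ring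
      _ ≤ w' x * (u x - f x) ^ 2 + |w x - w' x| * (4 * M ^ 2) := by
        gcongr
        exact le_abs_self _
      _ = _ := by ring
  have h3 : ENNReal.ofReal (1 / 2) ≤ 1 := by
    rw [← ENNReal.ofReal_one]
    exact ENNReal.ofReal_le_ofReal (by norm_num)
  unfold extendedEnergy
  calc _ ≤ ENNReal.ofReal (μ / 2) * energySeminormSq Ω ε γ u + ENNReal.ofReal (1 / 2) *
        (fidelity f w' u + ENNReal.ofReal (4 * M ^ 2) * ∫⁻ x in Ω, ‖w x - w' x‖ₑ) := by gcongr
    _ = ENNReal.ofReal (μ / 2) * energySeminormSq Ω ε γ u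
        + ENNReal.ofReal (1 / 2) * fidelity f w' u + ENNReal.ofReal (1 / 2) *
        (ENNReal.ofReal (4 * M ^ 2) * ∫⁻ x in Ω, ‖w x - w' x‖ₑ) := by ring
    _ ≤ _ := add_le_add le_rfl (mul_le_of_le_one_left zero_le h3)

theorem tendsto_lintegral_enorm_sub (hΩ : Bornology.IsBounded Ω) {s : ℕ → L2 Ω} {w : L2 Ω}
    (hs : Tendsto s atTop (𝓝 w)) :
    Tendsto (fun n => ∫⁻ x in Ω, ‖s n x - w x‖ₑ) atTop (𝓝 0) := by
  have h1 := (Lp.tendsto_Lp_iff_tendsto_eLpNorm' _ _).1 hs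
  have h2 : Tendsto (fun n => eLpNorm (⇑(s n) - ⇑w) 2 (volume.restrict Ω) *
      (volume.restrict Ω) univ ^ (1 / ENNReal.toReal 1 - 1 / ENNReal.toReal 2 : ℝ))
      atTop (𝓝 0) := by
    have hfin : volume Ω ≠ ⊤ := hΩ.measure_lt_top.ne
    have hpow : (volume.restrict Ω) univ ^ (1 / ENNReal.toReal 1 - 1 / ENNReal.toReal 2 : ℝ) ≠ ⊤ :=
      ENNReal.rpow_ne_top_of_nonneg (by norm_num) (by simpa using hfin)
    simpa using ENNReal.Tendsto.mul_const h1 (Or.inr hpow)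
  refine tendsto_of_tendsto_of_tendsto_of_le_of_le tendsto_const_nhds h2 (fun _ => zero_le)
    fun n => ?_
  have h3 := eLpNorm_le_eLpNorm_mul_rpow_measure_univ (μ := volume.restrict Ω)
    (p := 1) (q := 2) (f := ⇑(s n) - ⇑w) one_le_two
    ((Lp.aestronglyMeasurable (s n)).sub (Lp.aestronglyMeasurable w))
  rwa [eLpNorm_one_eq_lintegral_enorm] at h3

/-- Minimizers depend weakly continuously on the weight. -/
theorem IsDenoisingData.isEnergyMinimizer_of_tendsto (D : IsDenoisingData Ω ε γ f μ M)
    {ω : ℕ → L2 Ω} (hω : ∀ n, IsWeight Λ (ω n)) (hw : IsWeight Λ w)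
    (hlim : Tendsto ω atTop (𝓝 w)) {s : ℕ → L2 (extDomain Ω ε)}
    (hs : ∀ n, IsEnergyMinimizer Ω ε γ f μ (ω n) (s n)) {y : L2 (extDomain Ω ε)}
    (hy : ∀ S : Set (L2 (extDomain Ω ε)), Convex ℝ S → IsClosed S →
      (∀ᶠ n in atTop, s n ∈ S) → y ∈ S) :
    IsEnergyMinimizer Ω ε γ f μ w y := by
  obtain ⟨u, hu⟩ := D.exists_isEnergyMinimizer hw
  refine D.isEnergyMinimizer_of_forall_mem hw hy (D.ne_top_of_isEnergyMinimizer hw hu)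
    (fun n => (hs n).1) (fun c hc => ?_) hu.2
  set δ : ℕ → ENNReal := fun n => ENNReal.ofReal (4 * M ^ 2) * ∫⁻ x in Ω, ‖ω n x - w x‖ₑ with hδ
  have hδ' : ∀ n, ENNReal.ofReal (4 * M ^ 2) * ∫⁻ x in Ω, ‖w x - ω n x‖ₑ = δ n := fun n => by
    simp only [hδ, enorm_sub_rev]
  have hδ0 : Tendsto δ atTop (𝓝 0) := by
    simpa using ENNReal.Tendsto.const_mul (tendsto_lintegral_enorm_sub D.isBounded hlim)
      (Or.inr ENNReal.ofReal_ne_top)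
  -- Change the weight from w to `ω n`, use minimality of `s n` against u, and change back: each
  -- change costs `δ n`.
  have hbound : ∀ n, extendedEnergy Ω ε γ f μ w (s n)
      ≤ extendedEnergy Ω ε γ f μ w u + δ n + δ n := fun n => by
    have h1 := D.extendedEnergy_le_add (w := w) (D.ae_abs_le_of_isEnergyMinimizer (hω n) (hs n))
      (hω n)
    have h2 := D.extendedEnergy_le_add (w := ω n) (D.ae_abs_le_of_isEnergyMinimizer hw hu) hw
    rw [hδ'] at h1
    exact h1.trans (add_le_add (((hs n).2 u hu.1).trans h2) le_rfl)
  have hlim' : Tendsto (fun n => extendedEnergy Ω ε γ f μ w u + δ n + δ n) atTop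
      (𝓝 (extendedEnergy Ω ε γ f μ w u)) := by
    simpa using (hδ0.const_add (extendedEnergy Ω ε γ f μ w u)).add hδ0
  filter_upwards [hlim'.eventually_le_const hc] with n hn using (hbound n).trans hn

end

end NonlocalBilevel

namespace NonlocalBilevel

variable {d : ℕ} {Ω : Set (E d)} {ε : ℝ} {γ : E d → E d → ℝ} {f : E d → ℝ} {μ M Λ : ℝ}

/-! ### Convex upper-level functionals -/

/-- A convex function on a set stable under scaling that is continuous at `0` is bounded below on
bounded sets. -/
theorem exists_lower_bound_of_convexOn {F : Type*} [NormedAddCommGroup F] [NormedSpace ℝ F]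
    {V : Set F} {ℓ : F → ℝ} (hconv : ConvexOn ℝ V ℓ)
    (hcont : ContinuousWithinAt ℓ V 0) (hneg : ∀ v ∈ V, ∀ s : ℝ, s • v ∈ V) (R : ℝ) :
    ∃ b, ∀ v ∈ V, ‖v‖ ≤ R → b ≤ ℓ v := by
  obtain ⟨r, hr, hball⟩ := Metric.continuousWithinAt_iff.1 hcont 1 one_pos
  -- This s brings -s v into the ball where ℓ ≤ ℓ 0 + 1. Convexity at 0, a combination of v and -s
  -- v, then bounds ℓ v from below.
  set s : ℝ := r / (2 * (|R| + 1)) with hs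
  have hs0 : 0 < s := by positivity
  refine ⟨ℓ 0 - 1 / s, fun v hv hvR => ?_⟩
  have hsv : (-s) • v ∈ V := hneg v hv (-s)
  have hdist : dist ((-s) • v) 0 < r := by
    rw [dist_zero_right, norm_smul, norm_neg, Real.norm_of_nonneg hs0.le]
    calc s * ‖v‖ ≤ s * (|R| + 1) := by
          gcongr
          linarith [le_abs_self R]
      _ = r / 2 := by rw [hs]; field_simp
      _ < r := half_lt_self hr
  have h1 : ℓ ((-s) • v) ≤ ℓ 0 + 1 := by
    have := hball hsv hdist
    rw [Real.dist_eq] at this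
    linarith [le_abs_self (ℓ ((-s) • v) - ℓ 0)]
  have h2 := hconv.2 hv hsv (show 0 ≤ s / (1 + s) by positivity)
    (show 0 ≤ 1 / (1 + s) by positivity) (by field_simp; ring)
  have h3 : (s / (1 + s)) • v + (1 / (1 + s)) • (-s) • v = 0 := by
    rw [smul_smul, ← add_smul]
    have : s / (1 + s) + 1 / (1 + s) * -s = 0 := by ring
    rw [this, zero_smul]
  rw [h3, smul_eq_mul, smul_eq_mul] at h2
  have h4 : (1 + s) * ℓ 0 ≤ s * ℓ v + ℓ ((-s) • v) := by
    calc (1 + s) * ℓ 0 ≤ (1 + s) * (s / (1 + s) * ℓ v + 1 / (1 + s) * ℓ ((-s) • v)) := by gcongr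
      _ = _ := by field_simp
  rw [sub_le_iff_le_add, ← sub_le_iff_le_add', le_div_iff₀ hs0]
  linarith

/-- A convex function that is continuous on its domain does not exceed its limit along a sequence at
a point that lies in all closed convex sets containing a tail of that sequence. -/
theorem le_of_forall_mem_of_convexOn {F : Type*} [NormedAddCommGroup F] [NormedSpace ℝ F]
    {V : Set F} {ℓ : F → ℝ} (hconv : ConvexOn ℝ V ℓ) (hcont : ContinuousOn ℓ V)
    {s : ℕ → F} {y : F}
    (hy : ∀ S : Set F, Convex ℝ S → IsClosed S → (∀ᶠ n in atTop, s n ∈ S) → y ∈ S)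
    (hs : ∀ n, s n ∈ V) (hyV : y ∈ V) {a : ℝ} (ha : Tendsto (fun n => ℓ (s n)) atTop (𝓝 a)) :
    ℓ y ≤ a := by
  refine le_of_forall_gt_imp_ge_of_dense fun c hc => ?_
  -- V need not be closed, so the sublevel set in V is closed up first; continuity of ℓ at y within
  -- V recovers the inequality.
  have hmem : y ∈ closure {v ∈ V | ℓ v ≤ c} :=
    hy _ (hconv.convex_le c).closure isClosed_closure
      ((ha.eventually_le_const hc).mono fun n hn => subset_closure ⟨hs n, hn⟩)
  obtain ⟨v, hv, hvy⟩ := mem_closure_iff_seq_limit.1 hmem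
  have hlim : Tendsto (fun n => ℓ (v n)) atTop (𝓝 (ℓ y)) :=
    (hcont y hyV).tendsto.comp (tendsto_nhdsWithin_iff.2
      ⟨hvy, Eventually.of_forall fun n => (hv n).1⟩)
  exact le_of_tendsto hlim (Eventually.of_forall fun n => (hv n).2)

/-! ### Limits of weights -/

theorem isWeight_of_tendsto {s : ℕ → L2 Ω} {w : L2 Ω} (hs : ∀ n, IsWeight Λ (s n))
    (hlim : Tendsto s atTop (𝓝 w)) : IsWeight Λ w := by
  obtain ⟨φ, -, hφ⟩ := (tendstoInMeasure_of_tendsto_Lp hlim).exists_seq_tendsto_ae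
  filter_upwards [ae_all_iff.2 hs, hφ] with x h1 h2
  exact ⟨ge_of_tendsto' h2 fun n => (h1 _).1, le_of_tendsto' h2 fun n => (h1 _).2⟩

theorem exists_inner_eq_integral_mul {ψ : E d → ℝ} (hψ : Continuous ψ)
    (hψc : HasCompactSupport ψ) : ∃ b : L2 Ω, ∀ u : L2 Ω, inner ℝ b u = ∫ x in Ω, u x * ψ x := by
  have hL : MemLp ψ 2 (volume.restrict Ω) := (hψ.memLp_of_hasCompactSupport hψc).restrict Ω
  refine ⟨hL.toLp, fun u => ?_⟩
  rw [L2.inner_def]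
  refine integral_congr_ae ?_
  filter_upwards [hL.coeFn_toLp] with x hx
  rw [hx]
  rfl

/-- If weights converge in `L²(Ω)` and the squared norms of their gradients converge, then the limit
belongs to `H¹(Ω)` and its gradient does not exceed the limit. -/
theorem exists_H1_of_tendsto {ω : ℕ → H1 Ω} {w : L2 Ω}
    (hlim : Tendsto (fun n => (ω n).toLp) atTop (𝓝 w)) {q : ℝ}
    (hq : Tendsto (fun n => ∑ i, ‖(ω n).grad i‖ ^ 2) atTop (𝓝 q)) :
    ∃ w₀ : H1 Ω, w₀.toLp = w ∧ ∑ i, ‖w₀.grad i‖ ^ 2 ≤ q := by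
  have : Fact ((2 : ENNReal) ≠ ⊤) := ⟨by norm_num⟩
  have : SecondCountableTopology (L2 Ω) := Lp.SecondCountableTopology
  have : SecondCountableTopology (PiLp 2 (fun _ : Fin d => L2 Ω)) := inferInstance
  -- Collecting the partial derivatives in one Hilbert space yields one weak limit for the whole
  -- gradient.
  set x : ℕ → PiLp 2 (fun _ : Fin d => L2 Ω) := fun n => WithLp.toLp 2 (ω n).grad with hx
  have hxn : ∀ n, ‖x n‖ ^ 2 = ∑ i, ‖(ω n).grad i‖ ^ 2 := fun n =>
    PiLp.norm_sq_eq_of_L2 _ (x n)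
  have hq0 : 0 ≤ q := ge_of_tendsto' hq fun n => by positivity
  obtain ⟨Q, hQ⟩ := hq.bddAbove_range
  have hbdd : ∀ n, ‖x n‖ ≤ √Q := fun n =>
    Real.le_sqrt_of_sq_le ((hxn n).le.trans (hQ ⟨n, rfl⟩))
  obtain ⟨y, hy⟩ := exists_mem_of_eventually_mem_isClosed_convex hbdd
  refine ⟨⟨w, fun i => y i, fun i φ hφ hφc hφs => ?_⟩, rfl, ?_⟩
  · have hdc : Continuous fun x => fderiv ℝ φ x (EuclideanSpace.single i 1) :=
      (hφ.continuous_fderiv (by simp)).clm_apply continuous_const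
    obtain ⟨b, hb⟩ := exists_inner_eq_integral_mul (Ω := Ω) hφ.continuous hφc
    obtain ⟨b', hb'⟩ := exists_inner_eq_integral_mul (Ω := Ω) hdc
      (hφc.fderiv_apply ℝ (EuclideanSpace.single i 1))
    have hw : Tendsto (fun n => inner ℝ b' (ω n).toLp) atTop (𝓝 (inner ℝ b' w)) :=
      tendsto_const_nhds.inner hlim
    have hn : ∀ n, inner ℝ b (x n i) = -inner ℝ b' (ω n).toLp := fun n => by
      rw [hb, hb', (ω n).hasWeakPartial i φ hφ hφc hφs, neg_neg]
    set L : PiLp 2 (fun _ : Fin d => L2 Ω) →L[ℝ] ℝ :=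
      (innerSL ℝ b).comp (PiLp.proj 2 (fun _ : Fin d => L2 Ω) i) with hL
    have hLn : Tendsto (fun n => L (x n)) atTop (𝓝 (-inner ℝ b' w)) := by
      refine hw.neg.congr fun n => ?_
      rw [← hn]
      rfl
    -- Preimages under L of closed balls about the limit value are closed, convex and contain a
    -- tail, so L y equals that value.
    have hmem : ∀ η > 0, L y ∈ Metric.closedBall (-inner ℝ b' w) η := fun η hη =>
      hy (L ⁻¹' Metric.closedBall (-inner ℝ b' w) η)
        ((convex_closedBall _ _).linear_preimage L.toLinearMap)
        (Metric.isClosed_closedBall.preimage L.continuous)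
        (hLn.eventually (Metric.closedBall_mem_nhds _ hη))
    have hLy : L y = -inner ℝ b' w := by
      refine dist_le_zero.1 (le_of_forall_gt_imp_ge_of_dense fun η hη => ?_)
      exact hmem η hη
    rw [← hb', ← hb, ← neg_eq_iff_eq_neg]
    exact hLy.symm
  · have hle : ∀ c > q, ‖y‖ ^ 2 ≤ c := fun c hc => by
      have h1 : y ∈ Metric.closedBall (0 : PiLp 2 (fun _ : Fin d => L2 Ω)) (√c) :=
        hy _ (convex_closedBall _ _) Metric.isClosed_closedBall
          ((hq.eventually_le_const hc).mono fun n hn => by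
            rw [mem_closedBall_zero_iff]
            exact Real.le_sqrt_of_sq_le ((hxn n).le.trans hn))
      rw [mem_closedBall_zero_iff] at h1
      exact (Real.le_sqrt (norm_nonneg _) (hq0.trans hc.le)).1 h1
    have := PiLp.norm_sq_eq_of_L2 _ y
    rw [← this]
    exact le_of_forall_gt_imp_ge_of_dense hle

/-- The zero function as an element of `H¹(Ω)`. -/
def zeroH1 (Ω : Set (E d)) : H1 Ω where
  toLp := 0
  grad := 0
  hasWeakPartial i φ _ _ _ := by
    have h := Lp.coeFn_zero ℝ 2 (volume.restrict Ω)
    have h1 : ∀ ψ : E d → ℝ, ∫ x in Ω, (0 : L2 Ω) x * ψ x = 0 := fun ψ => by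
      refine (integral_congr_ae ?_).trans (integral_zero _ ℝ)
      filter_upwards [h] with x hx
      rw [hx]
      simp
    rw [h1, Pi.zero_apply, h1, neg_zero]

/-! ### The bilevel problem -/

/-- Invariance under negative scalings is what the lower bound for ℓ requires. -/
theorem IsDenoisingData.smul_mem_constrainedEnergySpace (D : IsDenoisingData Ω ε γ f μ M)
    {v : L2 (extDomain Ω ε)} (hv : v ∈ constrainedEnergySpace Ω ε γ) (s : ℝ) :
    s • v ∈ constrainedEnergySpace Ω ε γ := by
  have hcombo : s • v + (0 : ℝ) • v = s • v := by rw [zero_smul, add_zero]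
  refine ⟨?_, hcombo ▸ combo_mem_vanishingOnInteraction hv.2 hv.2 s 0⟩
  have h : energySeminormSq Ω ε γ (s • v) = ENNReal.ofReal (s ^ 2) * energySeminormSq Ω ε γ v := by
    simp only [energySeminormSq_eq_lintegral_prod D.kernel]
    rw [← lintegral_const_mul'' _ (aemeasurable_energy_integrand D.kernel v)]
    refine lintegral_congr_ae ?_
    filter_upwards [ae_prod_of_ae (Lp.coeFn_smul s v)] with z hz
    rw [hz.1, hz.2, ← ENNReal.ofReal_mul (sq_nonneg s)]
    simp only [Pi.smul_apply, smul_eq_mul]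
    congr 1
    ring
  rw [h]
  exact ENNReal.mul_lt_top ENNReal.ofReal_lt_top hv.1

theorem IsDenoisingData.zero_mem_constrainedEnergySpace (D : IsDenoisingData Ω ε γ f μ M) :
    (0 : L2 (extDomain Ω ε)) ∈ constrainedEnergySpace Ω ε γ :=
  ⟨by rw [energySeminormSq_zero D.kernel]; exact ENNReal.zero_lt_top,
    zero_mem_vanishingOnInteraction⟩

theorem IsDenoisingData.exists_bilevel_solution (D : IsDenoisingData Ω ε γ f μ M) (hΛ : 0 < Λ)
    {β : ℝ} (hβ : 0 < β) {ℓ : L2 (extDomain Ω ε) → ℝ}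
    (hconv : ConvexOn ℝ (constrainedEnergySpace Ω ε γ) ℓ)
    (hcont : ContinuousOn ℓ (constrainedEnergySpace Ω ε γ)) :
    ∃ w₀ ∈ admissibleWeights Ω Λ, ∃ u₀, IsDenoised Ω ε γ f μ w₀.toLp u₀ ∧
      ∀ w ∈ admissibleWeights Ω Λ, ∀ u, IsDenoised Ω ε γ f μ w.toLp u →
        bilevelObjective ℓ β u₀ w₀ ≤ bilevelObjective ℓ β u w := by
  obtain ⟨R, hR⟩ := exists_norm_le_of_ae_abs_le D.isBounded ε M D.bound_nonneg
  obtain ⟨b, hb⟩ := exists_lower_bound_of_convexOn hconv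
    (hcont 0 D.zero_mem_constrainedEnergySpace)
    (fun v hv s => D.smul_mem_constrainedEnergySpace hv s) R
  have hnormR : ∀ {w : H1 Ω} {u}, w ∈ admissibleWeights Ω Λ → IsDenoised Ω ε γ f μ w.toLp u →
      ‖u‖ ≤ R := fun {w u} hw hu =>
    hR u (D.ae_abs_le_of_isEnergyMinimizer hw ((D.isDenoised_iff hw).1 hu))
  have hlow : ∀ {w : H1 Ω} {u}, w ∈ admissibleWeights Ω Λ → IsDenoised Ω ε γ f μ w.toLp u →
      b ≤ ℓ u := fun {w u} hw hu => hb u hu.1 (hnormR hw hu)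
  have hnormSq : ∀ w : H1 Ω, 0 ≤ w.normSq := fun w => by unfold H1.normSq; positivity
  set A : Set ℝ := {t | ∃ w ∈ admissibleWeights Ω Λ, ∃ u, IsDenoised Ω ε γ f μ w.toLp u ∧
    bilevelObjective ℓ β u w = t} with hA
  have hAne : A.Nonempty := by
    have h0 : zeroH1 Ω ∈ admissibleWeights Ω Λ := by
      filter_upwards [Lp.coeFn_zero ℝ 2 (volume.restrict Ω)] with x hx
      rw [zeroH1, hx]
      exact ⟨le_rfl, hΛ.le⟩
    obtain ⟨u, hu⟩ := D.exists_isEnergyMinimizer (w := (zeroH1 Ω).toLp) h0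
    exact ⟨_, zeroH1 Ω, h0, u, (D.isDenoised_iff h0).2 hu, rfl⟩
  have hAbdd : BddBelow A := by
    refine ⟨b, ?_⟩
    rintro t ⟨w, hw, u, hu, rfl⟩
    have := mul_nonneg (half_pos hβ).le (hnormSq w)
    exact (hlow hw hu).trans (le_add_of_nonneg_right this)
  obtain ⟨t, ht_anti, ht, htA⟩ := exists_seq_tendsto_sInf hAne hAbdd
  choose ω hω s hs hst using htA
  have hℓt : ∀ n, ℓ (s n) + β / 2 * (ω n).normSq = t n := hst
  have ht0 : ∀ n, t n ≤ t 0 := fun n => ht_anti (Nat.zero_le n)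
  -- From β/2 times the squared H¹ norm ≤ t 0 - b, as ℓ ≥ b at every state.
  set Q : ℝ := (t 0 - b) * (2 / β) with hQ
  have hQn : ∀ n, (ω n).normSq ≤ Q := fun n => by
    rw [hQ, mul_div_assoc', le_div_iff₀ hβ]
    linarith [hlow (hω n) (hs n), hℓt n, ht0 n]
  have hQ1 : ∀ n, ‖(ω n).toLp‖ ≤ √Q := fun n => by
    refine Real.le_sqrt_of_sq_le (le_trans ?_ (hQn n))
    exact le_add_of_nonneg_right (by positivity)
  have hQ2 : ∀ n, ∑ i, ‖(ω n).grad i‖ ≤ ∑ _ : Fin d, √Q := fun n => by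
    refine Finset.sum_le_sum fun i _ => Real.le_sqrt_of_sq_le (le_trans ?_ (hQn n))
    refine le_trans ?_ (le_add_of_nonneg_left (sq_nonneg _))
    exact Finset.single_le_sum (f := fun i => ‖(ω n).grad i‖ ^ 2) (fun _ _ => sq_nonneg _)
      (Finset.mem_univ i)
  obtain ⟨φ, hφ, w, hw⟩ := exists_subseq_tendsto_weights D.isOpen D.isBounded hΛ ω
    (fun n => IsWeight.abs_le (hω n)) hQ1 hQ2
  have hℓmem : ∀ n, ℓ (s (φ n)) ∈ Icc b (t 0) := fun n => by
    refine ⟨hlow (hω _) (hs _), ?_⟩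
    have := mul_nonneg (half_pos hβ).le (hnormSq (ω (φ n)))
    linarith [hℓt (φ n), ht0 (φ n)]
  -- With ℓ convergent too, the convergent objective and the strong L² limit of the weights force
  -- the squared gradient norms to converge.
  obtain ⟨a, -, ψ, hψ, ha⟩ := isCompact_Icc.tendsto_subseq hℓmem
  set k : ℕ → ℕ := φ ∘ ψ with hk
  have hkt : Tendsto k atTop atTop := (hφ.comp hψ).tendsto_atTop
  have hwk : Tendsto (fun n => (ω (k n)).toLp) atTop (𝓝 w) := hw.comp hψ.tendsto_atTop
  have hak : Tendsto (fun n => ℓ (s (k n))) atTop (𝓝 a) := ha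
  have hgrad : Tendsto (fun n => ∑ i, ‖(ω (k n)).grad i‖ ^ 2) atTop
      (𝓝 ((sInf A - a) * (2 / β) - ‖w‖ ^ 2)) := by
    refine ((((ht.comp hkt).sub hak).mul_const (2 / β)).sub (hwk.norm.pow 2)).congr fun n => ?_
    have h1 := hℓt (k n)
    rw [H1.normSq] at h1
    simp only [Function.comp_apply]
    rw [← h1]
    field_simp
    ring
  obtain ⟨w₀, hw₀, hw₀q⟩ := exists_H1_of_tendsto hwk hgrad
  have hadm : IsWeight Λ w := isWeight_of_tendsto (fun n => hω (k n)) hwk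
  have := separableSpace_L2 (extDomain Ω ε)
  obtain ⟨y, hy⟩ := exists_mem_of_eventually_mem_isClosed_convex
    (fun n => hnormR (hω (k n)) (hs (k n)))
  have hmin : IsEnergyMinimizer Ω ε γ f μ w y :=
    D.isEnergyMinimizer_of_tendsto (fun n => hω (k n)) hadm hwk
      (fun n => (D.isDenoised_iff (hω (k n))).1 (hs (k n))) hy
  have hden : IsDenoised Ω ε γ f μ w y := (D.isDenoised_iff hadm).2 hmin
  have hℓy : ℓ y ≤ a := le_of_forall_mem_of_convexOn hconv hcont hy (fun n => (hs (k n)).1)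
    hden.1 hak
  subst hw₀
  refine ⟨w₀, hadm, y, hden, fun w' hw' u hu => ?_⟩
  refine le_trans ?_ (csInf_le hAbdd ⟨w', hw', u, hu, rfl⟩)
  have h1 : w₀.normSq ≤ (sInf A - a) * (2 / β) := by
    unfold H1.normSq
    linarith
  calc bilevelObjective ℓ β y w₀ ≤ a + β / 2 * ((sInf A - a) * (2 / β)) := by
        unfold bilevelObjective
        gcongr
    _ = sInf A := by field_simp; ring

end NonlocalBilevel

end

theorem mainTheorem5 {d : ℕ} (hd : 1 ≤ d)
    (Ω : Set (NonlocalBilevel.E d)) (hΩ_open : IsOpen Ω) (hΩ_conn : IsConnected Ω)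
    (hΩ_bdd : Bornology.IsBounded Ω)
    (ε : ℝ) (hε : 0 < ε)
    (γ : NonlocalBilevel.E d → NonlocalBilevel.E d → ℝ)
    (hγ : NonlocalBilevel.IsLocalizedKernel Ω ε γ)
    (f : NonlocalBilevel.E d → ℝ) (hf : MemLp f ⊤ (volume.restrict Ω))
    (μ β Λ : ℝ) (hμ : 0 < μ) (hβ : 0 < β) (hΛ : 0 < Λ)
    (ℓ : NonlocalBilevel.L2 (NonlocalBilevel.extDomain Ω ε) → ℝ)
    (hℓ_conv : StrictConvexOn ℝ (NonlocalBilevel.constrainedEnergySpace Ω ε γ) ℓ)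
    (hℓ_cont : ContinuousOn ℓ (NonlocalBilevel.constrainedEnergySpace Ω ε γ)) :
    (∀ w ∈ NonlocalBilevel.admissibleWeights Ω Λ,
      ∃! u, NonlocalBilevel.IsDenoised Ω ε γ f μ w.toLp u) ∧
    ∃ w₀ ∈ NonlocalBilevel.admissibleWeights Ω Λ,
      ∃ u₀, NonlocalBilevel.IsDenoised Ω ε γ f μ w₀.toLp u₀ ∧
        ∀ w ∈ NonlocalBilevel.admissibleWeights Ω Λ,
          ∀ u, NonlocalBilevel.IsDenoised Ω ε γ f μ w.toLp u →
            NonlocalBilevel.bilevelObjective ℓ β u₀ w₀ ≤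
              NonlocalBilevel.bilevelObjective ℓ β u w := by
  have D : NonlocalBilevel.IsDenoisingData Ω ε γ f μ
      -- The truncation level M is the essential supremum of |f|.
      (eLpNorm f ⊤ (volume.restrict Ω)).toReal := by
    refine ⟨hd, hΩ_open, hΩ_bdd, hε, hγ, hf.aestronglyMeasurable.aemeasurable,
      ENNReal.toReal_nonneg, ?_, hμ⟩
    filter_upwards [ae_le_eLpNormEssSup (f := f) (μ := volume.restrict Ω)] with x hx
    have := ENNReal.toReal_mono hf.eLpNorm_ne_top (hx.trans_eq eLpNorm_exponent_top.symm)
    simpa using this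
  refine ⟨fun w hw => ?_, D.exists_bilevel_solution hΛ hβ hℓ_conv.convexOn hℓ_cont⟩
  obtain ⟨u, hu⟩ := D.exists_isEnergyMinimizer hw
  exact ⟨u, (D.isDenoised_iff hw).2 hu, fun v hv =>
    D.isEnergyMinimizer_unique hw ((D.isDenoised_iff hw).1 hv) hu⟩
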